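/- A parameterized problem is a decision problem whose instances $x$ are encoded injectively as binary words, together with a parameter $\kappa(x)\in\mathbb N$. An fpt-reduction from $P$ to $Q$ is a map $r$ from the instances of $P$ to those of $Q$ such that (i) $x$ is a yes-instance of $P$ if and only if $r(x)$ is a yes-instance of $Q$; (ii) some deterministic Turing machine computes $r(x)$ from $x$ in at most $f(\kappa(x))\,(|x|+1)^{c}$ steps; (iii) $\kappa(r(x))\le g(\kappa(x))$, for some computable functions $f,g:\mathbb N\to\mathbb N$ and some constant $c$. Consider Boolean circuits with one output, built from NOT gates and AND and OR gates of arbitrary fan-in. The depth of a circuit is the maximum number of gates on a path to the output, and its weft is the maximum number of gates of fan-in greater than $2$ on such a path. The class $\mathrm W[2]$ consists of the parameterized problems that, for some constant $h$, have an fpt-reduction to the following problem: given a circuit $C$ of weft at most $2$ and depth at most $h$, and an integer $k\ge 0$ (the parameter), does $C$ accept some input of Hamming weight exactly $k$? For sets $\sigma,\rho\subseteq\mathbb N$ of non-negative integers, a set $D$ of vertices of a finite simple undirected graph $G$ is $(\sigma,\rho)$-dominating if $|N(v)\cap D|\in\sigma$ for every vertex $v\in D$ and $|N(v)\cap D|\in\rho$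 for every vertex $v\notin D$, where $N(v)$ is the set of neighbours of $v$. The problem $(\sigma,\rho)$-Dominating Set of Size at Most $k$ is: given a finite simple graph $G$ and an integer $k\ge 0$ (the parameter), does $G$ have a $(\sigma,\rho)$-dominating set $D$ with $|D|\le k$? Theorem. For all recursive (decidable) sets $\sigma,\rho\subseteq\mathbb N$, the problem $(\sigma,\rho)$-Dominating Set of Size at Most $k$, parameterized by $k$, belongs to $\mathrm W[2]$. -/

import Mathlib

namespace ParamComplexity

/-! ### Self-delimiting binary codes -/

/-- A code is prefix-free (self-delimiting) if concatenations can be parsed uniquely. -/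
def PrefixFree {α : Type} (e : α → List Bool) : Prop :=
  ∀ a b s t, e a ++ s = e b ++ t → a = b ∧ s = t

/-- The unary code `1ⁿ0` of a natural number. -/
def encodeNat : ℕ → List Bool
  | 0 => [false]
  | n + 1 => true :: encodeNat n

/-- The code of a list: every entry is announced by a `1`, the end of the list by a `0`. -/
def encodeList {α : Type} (e : α → List Bool) : List α → List Bool
  | [] => [false]
  | a :: l => true :: (e a ++ encodeList e l)

theorem prefixFree_encodeNat : PrefixFree encodeNat := by
  intro a
  induction a with
  | zero => rintro (_ | b) s t h <;> simp_all [encodeNat]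
  | succ a ih =>
    rintro (_ | b) s t h
    · simp [encodeNat] at h
    · simp only [encodeNat, List.cons_append, List.cons.injEq, true_and] at h
      obtain ⟨h₁, h₂⟩ := ih b s t h
      exact ⟨by rw [h₁], h₂⟩

theorem prefixFree_encodeList {α : Type} {e : α → List Bool} (he : PrefixFree e) :
    PrefixFree (encodeList e) := by
  intro a
  induction a with
  | nil => rintro (_ | ⟨b, m⟩) s t h <;> simp_all [encodeList]
  | cons a l ih =>
    rintro (_ | ⟨b, m⟩) s t h
    · simp [encodeList] at h
    · simp only [encodeList, List.cons_append, List.cons.injEq, true_and,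
        List.append_assoc] at h
      obtain ⟨h₁, h₂⟩ := he _ _ _ _ h
      obtain ⟨h₃, h₄⟩ := ih m s t h₂
      exact ⟨by rw [h₁, h₃], h₄⟩

/-! ### Parameterized problems and fpt-reductions -/

/-- A parameterized decision problem: instances are encoded injectively as binary words, each
instance has a parameter, and some of the instances are yes-instances. -/
structure ParamProblem where
  /-- the instances -/
  Inst : Type
  /-- the parameter of an instance -/
  param : Inst → ℕ
  /-- the binary word that represents an instance -/
  encode : Inst → List Bool
  encode_injective : Function.Injective encode
  /-- the yes-instances -/
  Yes : Inst → Prop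

/-- `FPTReducible P Q`: there is a many-one reduction from `P` to `Q` that
a (deterministic, multi-stack) Turing machine computes in at most `f(k) · (|x| + 1)^c` steps, where
`k` is the parameter and `|x|` the length of the input word, and under which the new parameter is at
most `g(k)`; here `f` and `g` are computable functions and `c` is a constant. -/
def FPTReducible (P Q : ParamProblem) : Prop :=
  ∃ (r : P.Inst → Q.Inst) (f g : ℕ → ℕ) (c : ℕ) (M : Turing.TM2ComputableAux Bool Bool),
    Computable f ∧ Computable g ∧
    (∀ x, P.Yes x ↔ Q.Yes (r x)) ∧
    (∀ x, Q.param (r x) ≤ g (P.param x)) ∧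
    (∀ x, Nonempty (Turing.TM2OutputsInTime M.tm
      ((P.encode x).map M.inputAlphabet.symm)
      (some ((Q.encode (r x)).map M.outputAlphabet.symm))
      (f (P.param x) * ((P.encode x).length + 1) ^ c)))

/-! ### Boolean circuits, depth and weft -/

/-- A gate of a Boolean circuit, with the list of the nodes that feed it. -/
inductive Gate where
  | not (a : ℕ)
  | and (as : List ℕ)
  | or (as : List ℕ)

namespace Gate

/-- The nodes that feed a gate. -/
def args : Gate → List ℕ
  | not a => [a]
  | and as => as
  | or as => as

/-- The output of a gate when node `i` carries the value `v i`. -/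
def eval (v : ℕ → Bool) : Gate → Bool
  | not a => !v a
  | and as => as.all v
  | or as => as.any v

/-- A gate is large if its fan-in exceeds two. -/
def isLarge (g : Gate) : Bool := decide (2 < g.args.length)

/-- The largest value of `d` on the nodes that feed the gate (`0` if there are none). -/
def maxArg (d : ℕ → ℕ) (g : Gate) : ℕ := (g.args.map d).foldr max 0

/-- The binary code of a gate. -/
def encode : Gate → List Bool
  | not a => false :: encodeNat a
  | and as => true :: false :: encodeList encodeNat as
  | or as => true :: true :: encodeList encodeNat as

theorem prefixFree_encode : PrefixFree encode := by
  have hl := prefixFree_encodeList prefixFree_encodeNat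
  rintro (a | a | a) (b | b | b) s t h <;> simp only [encode, List.cons_append, List.cons.injEq,
    reduceCtorEq, false_and, true_and] at h
  · obtain ⟨h₁, h₂⟩ := prefixFree_encodeNat _ _ _ _ h
    exact ⟨by rw [h₁], h₂⟩
  · obtain ⟨h₁, h₂⟩ := hl _ _ _ _ h
    exact ⟨by rw [h₁], h₂⟩
  · obtain ⟨h₁, h₂⟩ := hl _ _ _ _ h
    exact ⟨by rw [h₁], h₂⟩

end Gate

/-- Goes through a list of gates in order and appends to `vals`, the list of the values of the
earlier nodes, the value `step v g` of each gate `g`, where `v i` is the value of node `i`. -/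
def runGates {β : Type} [Inhabited β] (step : (ℕ → β) → Gate → β) :
    List β → List Gate → List β
  | vals, [] => vals
  | vals, g :: gs => runGates step (vals ++ [step (fun i => vals.getD i default) g]) gs

/-- A Boolean circuit with one output. The nodes `0, …, numInputs - 1` are the inputs, node
`numInputs + i` is the `i`-th gate, and every gate is fed by earlier nodes only. -/
@[ext]
structure Circuit where
  /-- the number of inputs -/
  numInputs : ℕ
  /-- the gates, in topological order -/
  gates : List Gate
  /-- the output node -/
  output : ℕ
  args_lt : ∀ (i : ℕ) (hi : i < gates.length), ∀ a ∈ gates[i].args, a < numInputs + i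
  output_lt : output < numInputs + gates.length

namespace Circuit

/-- The output of the circuit on the input `x`. -/
def eval (C : Circuit) (x : Fin C.numInputs → Bool) : Bool :=
  (runGates Gate.eval (List.ofFn x) C.gates).getD C.output false

/-- The depth: the maximum number of gates on a path to the output. -/
def depth (C : Circuit) : ℕ :=
  (runGates (fun d g => 1 + g.maxArg d) (List.replicate C.numInputs 0) C.gates).getD C.output 0

/-- The weft: the maximum number of large gates on a path to the output. -/
def weft (C : Circuit) : ℕ :=
  (runGates (fun d g => (if g.isLarge then 1 else 0) + g.maxArg d)
    (List.replicate C.numInputs 0) C.gates).getD C.output 0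

/-- Some input with exactly `k` ones is accepted. -/
def WeightedSat (C : Circuit) (k : ℕ) : Prop :=
  ∃ x : Fin C.numInputs → Bool,
    (Finset.univ.filter fun i => x i = true).card = k ∧ C.eval x = true

/-- The binary code of a circuit. -/
def encode (C : Circuit) : List Bool :=
  encodeNat C.numInputs ++ (encodeList Gate.encode C.gates ++ encodeNat C.output)

theorem encode_injective : Function.Injective encode := by
  intro C D h
  obtain ⟨h₁, h⟩ := prefixFree_encodeNat _ _ _ _ h
  obtain ⟨h₂, h⟩ := prefixFree_encodeList Gate.prefixFree_encode _ _ _ _ h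
  obtain ⟨h₃, -⟩ := prefixFree_encodeNat C.output D.output [] [] (by simpa using h)
  exact Circuit.ext h₁ h₂ h₃

end Circuit

/-- Weighted satisfiability of circuits of weft at most `t` and depth at most `h`: given such a
circuit and `k`, is there an accepted input of Hamming weight `k`? The parameter is `k`. -/
def weightedCircuitSat (t h : ℕ) : ParamProblem where
  Inst := {C : Circuit // C.weft ≤ t ∧ C.depth ≤ h} × ℕ
  param x := x.2
  encode x := encodeNat x.2 ++ x.1.1.encode
  encode_injective := by
    rintro ⟨⟨C, hC⟩, k⟩ ⟨⟨D, hD⟩, l⟩ h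
    obtain ⟨h₁, h₂⟩ := prefixFree_encodeNat _ _ _ _ h
    obtain rfl := Circuit.encode_injective h₂
    obtain rfl : k = l := h₁
    rfl
  Yes x := x.1.1.WeightedSat x.2

/-- The class `W[t]`: the parameterized problems that are fpt-reducible to weighted satisfiability
of circuits of weft at most `t` and depth at most `h`, for some constant `h`. -/
def W (t : ℕ) : Set ParamProblem :=
  {P | ∃ h : ℕ, FPTReducible P (weightedCircuitSat t h)}

/-! ### `(σ, ρ)`-domination -/

/-- `D` is a `(σ, ρ)`-dominating set of the graph `G`. -/
def IsSigmaRhoDominating {V : Type} (σ ρ : Set ℕ) (G : SimpleGraph V) (D : Finset V) : Prop :=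
  (∀ v ∈ D, (G.neighborSet v ∩ D).ncard ∈ σ) ∧ (∀ v ∉ D, (G.neighborSet v ∩ D).ncard ∈ ρ)

/-- A finite graph, on the vertices `0, …, n - 1`, together with a number `k`. -/
structure GraphInst where
  /-- the number of vertices -/
  n : ℕ
  /-- the graph -/
  G : SimpleGraph (Fin n)
  /-- the bound on the size of the set -/
  k : ℕ

open Classical in
/-- The rows of the adjacency matrix of a graph, one after the other. -/
noncomputable def adjBits {n : ℕ} (G : SimpleGraph (Fin n)) : List Bool :=
  (List.finRange n).flatMap fun i => (List.finRange n).map fun j => decide (G.Adj i j)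

theorem adjBits_injective {n : ℕ} : Function.Injective (adjBits (n := n)) := by
  classical
  intro G H h
  have key : ∀ l : List (Fin n),
      (l.flatMap fun i => (List.finRange n).map fun j => decide (G.Adj i j)) =
        (l.flatMap fun i => (List.finRange n).map fun j => decide (H.Adj i j)) →
      ∀ i ∈ l, ∀ j, G.Adj i j ↔ H.Adj i j := by
    intro l
    induction l with
    | nil => simp
    | cons a l ih =>
      intro hl i hi j
      rw [List.flatMap_cons, List.flatMap_cons] at hl
      obtain ⟨h₁, h₂⟩ := List.append_inj hl (by simp)
      rcases List.mem_cons.1 hi with rfl | hi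
      · simpa using List.map_inj_left.1 h₁ j (List.mem_finRange j)
      · exact ih h₂ i hi j
  ext i j
  refine key (List.finRange n) ?_ i (List.mem_finRange i) j
  unfold adjBits at h
  convert h

/-- The binary code of a graph and a number `k`: `n` and `k` in unary, then the adjacency matrix. -/
noncomputable def GraphInst.encode (x : GraphInst) : List Bool :=
  encodeNat x.n ++ (encodeNat x.k ++ adjBits x.G)

theorem GraphInst.encode_injective : Function.Injective GraphInst.encode := by
  rintro ⟨n, G, k⟩ ⟨m, H, l⟩ h
  obtain ⟨h₁, h⟩ := prefixFree_encodeNat _ _ _ _ h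
  obtain ⟨h₂, h₃⟩ := prefixFree_encodeNat _ _ _ _ h
  obtain rfl : n = m := h₁
  obtain rfl : k = l := h₂
  obtain rfl : G = H := adjBits_injective h₃
  rfl

/-- `(σ, ρ)`-Dominating Set of Size at Most `k`: given a graph `G` and `k`, is there a
`(σ, ρ)`-dominating set of `G` with at most `k` vertices? The parameter is `k`. -/
noncomputable def sigmaRhoDominatingSet (σ ρ : Set ℕ) : ParamProblem where
  Inst := GraphInst
  param x := x.k
  encode := GraphInst.encode
  encode_injective := GraphInst.encode_injective
  Yes x := ∃ D : Finset (Fin x.n), IsSigmaRhoDominating σ ρ x.G D ∧ D.card ≤ x.k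

end ParamComplexity

/-!
For an instance with `n` vertices and parameter `k`, let `k` slots each hold one of `n + 1` choices:
a vertex, or no vertex. The variable `y_{p,i}` says that slot `i` holds the choice `p`. If every
slot holds some choice (one clause per slot), then weight exactly `k` makes the choices unique.
Relative to a vertex `v`, a choice is of kind `0` (it is `v`), `1` (a neighbour of `v`) or `2`
(anything else), and the word of kinds in the `k` slots decides whether the condition at `v` holds.
Each of the at most `3 ^ k` forbidden words `b` is excluded by the monotone clause consisting of all
`y_{p,i}` for which the kind of `p` relative to `v` differs from `b_i`. So the condition becomes a
monotone formula in conjunctive normal form, a circuit of depth and weft at most `2`.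

Which words are forbidden depends on `σ`, `ρ` and `k` only. A machine compiled from a code of a
computable function finds them; its running time is again a computable function of `k`, because
the number of steps is partial recursive. The clauses are then written in polynomial time.
-/

namespace ParamComplexity

/-! ### A structured language of stack programs -/

/-- Programs that act on stacks of bits indexed by `K`. A branch or a loop tests the top of a stack,
which is `none` if the stack is empty. -/
inductive StackProg (K : Type) where
  | push (k : K) (b : Bool)
  | pop (k : K)
  | seq (p q : StackProg K)
  | ite (k : K) (c : Option Bool → Bool) (p q : StackProg K)
  | loop (k : K) (c : Option Bool → Bool) (p : StackProg K)

namespace StackProg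

infixr:60 " ;; " => StackProg.seq

variable {K : Type} [DecidableEq K]

/-- `Runs p S t S'`: started on the stacks `S`, the program `p` stops after exactly `t` steps with
the stacks `S'`. -/
inductive Runs : StackProg K → (K → List Bool) → ℕ → (K → List Bool) → Prop
  | push (k b S) : Runs (.push k b) S 1 (Function.update S k (b :: S k))
  | pop (k S) : Runs (.pop k) S 1 (Function.update S k (S k).tail)
  | seq {p q S S₁ S₂ t₁ t₂} : Runs p S t₁ S₁ → Runs q S₁ t₂ S₂ → Runs (.seq p q) S (t₁ + t₂) S₂
  | ite_true {k c p q S S₁ t} : c (S k).head? = true → Runs p S t S₁ →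
      Runs (.ite k c p q) S (t + 1) S₁
  | ite_false {k c p q S S₁ t} : c (S k).head? = false → Runs q S t S₁ →
      Runs (.ite k c p q) S (t + 1) S₁
  | loop_true {k c p S S₁ S₂ t₁ t₂} : c (S k).head? = true → Runs p S t₁ S₁ →
      Runs (.loop k c p) S₁ t₂ S₂ → Runs (.loop k c p) S (1 + t₁ + t₂) S₂
  | loop_false {k c p S} : c (S k).head? = false → Runs (.loop k c p) S 1 S

/-- `RunsIn p S T S'`: the program `p` leads from `S` to `S'` in at most `T` steps. -/
def RunsIn (p : StackProg K) (S : K → List Bool) (T : ℕ) (S' : K → List Bool) : Prop :=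
  ∃ t ≤ T, Runs p S t S'

section rules

variable {p q : StackProg K} {S S₁ S₂ : K → List Bool} {T T₁ T₂ : ℕ} {k : K}
  {c : Option Bool → Bool}

theorem Runs.runsIn {t : ℕ} (h : Runs p S t S₁) : RunsIn p S t S₁ := ⟨t, le_rfl, h⟩

theorem RunsIn.mono (h : RunsIn p S T₁ S₁) (hT : T₁ ≤ T₂) : RunsIn p S T₂ S₁ :=
  let ⟨t, ht, hr⟩ := h
  ⟨t, ht.trans hT, hr⟩

theorem RunsIn.congr (h : RunsIn p S T₁ S₁) (hT : T₁ ≤ T₂) (hS : S₁ = S₂) : RunsIn p S T₂ S₂ :=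
  hS ▸ h.mono hT

theorem RunsIn.seq (h₁ : RunsIn p S T₁ S₁) (h₂ : RunsIn q S₁ T₂ S₂) :
    RunsIn (p ;; q) S (T₁ + T₂) S₂ :=
  let ⟨_, ht, hr⟩ := h₁
  let ⟨_, ht', hr'⟩ := h₂
  ⟨_, Nat.add_le_add ht ht', .seq hr hr'⟩

theorem runsIn_push (k : K) (b : Bool) (S : K → List Bool) :
    RunsIn (.push k b) S 1 (Function.update S k (b :: S k)) := (Runs.push k b S).runsIn

theorem runsIn_pop (k : K) (S : K → List Bool) :
    RunsIn (.pop k) S 1 (Function.update S k (S k).tail) := (Runs.pop k S).runsIn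

theorem RunsIn.ite_true (hc : c (S k).head? = true) (h : RunsIn p S T S₁) :
    RunsIn (.ite k c p q) S (T + 1) S₁ :=
  let ⟨_, ht, hr⟩ := h
  ⟨_, Nat.add_le_add_right ht 1, .ite_true hc hr⟩

theorem RunsIn.ite_false (hc : c (S k).head? = false) (h : RunsIn q S T S₁) :
    RunsIn (.ite k c p q) S (T + 1) S₁ :=
  let ⟨_, ht, hr⟩ := h
  ⟨_, Nat.add_le_add_right ht 1, .ite_false hc hr⟩

theorem RunsIn.loop_true (hc : c (S k).head? = true) (h₁ : RunsIn p S T₁ S₁)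
    (h₂ : RunsIn (.loop k c p) S₁ T₂ S₂) : RunsIn (.loop k c p) S (1 + T₁ + T₂) S₂ :=
  let ⟨_, ht, hr⟩ := h₁
  let ⟨_, ht', hr'⟩ := h₂
  ⟨_, by omega, .loop_true hc hr hr'⟩

theorem RunsIn.loop_false (hc : c (S k).head? = false) : RunsIn (.loop k c p) S 1 S :=
  (Runs.loop_false hc).runsIn

end rules

/-- Rename the stacks of a program. -/
def map {K L : Type} (f : K → L) : StackProg K → StackProg L
  | push k b => .push (f k) b
  | pop k => .pop (f k)
  | seq p q => .seq (p.map f) (q.map f)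
  | ite k c p q => .ite (f k) c (p.map f) (q.map f)
  | loop k c p => .loop (f k) c (p.map f)

theorem update_extend {L β : Type*} [DecidableEq L] {f : K → L} (hf : Function.Injective f)
    (S : K → β) (R : L → β) (k : K) (x : β) :
    Function.update (Function.extend f S R) (f k) x =
      Function.extend f (Function.update S k x) R := by
  funext j
  by_cases hj : ∃ i, f i = j
  · obtain ⟨i, rfl⟩ := hj
    by_cases hi : i = k
    · simp [hi, hf.extend_apply]
    · simp [hi, hf.extend_apply, hf.eq_iff]
  · have hk : j ≠ f k := fun h => hj ⟨k, h.symm⟩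
    simp [hk, Function.extend_apply' _ _ _ hj]

theorem Runs.map {L : Type} [DecidableEq L] {f : K → L} (hf : Function.Injective f)
    {p : StackProg K} {S S' : K → List Bool} {t : ℕ} (h : Runs p S t S') (R : L → List Bool) :
    Runs (p.map f) (Function.extend f S R) t (Function.extend f S' R) := by
  induction h with
  | push k b S =>
    rw [← update_extend hf, ← hf.extend_apply S R k]
    exact .push (f k) b _
  | pop k S =>
    rw [← update_extend hf, ← hf.extend_apply S R k]
    exact .pop (f k) _
  | seq _ _ ih₁ ih₂ => exact .seq ih₁ ih₂
  | ite_true hc _ ih => exact .ite_true (by rwa [hf.extend_apply]) ih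
  | ite_false hc _ ih => exact .ite_false (by rwa [hf.extend_apply]) ih
  | loop_true hc _ _ ih₁ ih₂ => exact .loop_true (by rwa [hf.extend_apply]) ih₁ ih₂
  | loop_false hc => exact .loop_false (by rwa [hf.extend_apply])

theorem sum_length_update_le [Fintype K] (S : K → List Bool) {k : K} {l : List Bool}
    (hl : l.length ≤ (S k).length + 1) :
    ∑ j, (Function.update S k l j).length ≤ ∑ j, (S j).length + 1 := by
  have hrest : ∑ j ∈ Finset.univ.erase k, (Function.update S k l j).length =
      ∑ j ∈ Finset.univ.erase k, (S j).length :=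
    Finset.sum_congr rfl fun j hj => by rw [Function.update_of_ne (Finset.ne_of_mem_erase hj)]
  rw [← Finset.add_sum_erase _ _ (Finset.mem_univ k),
    ← Finset.add_sum_erase _ (fun j => (S j).length) (Finset.mem_univ k), hrest,
    Function.update_self]
  omega

theorem Runs.sum_length_le [Fintype K] {p : StackProg K} {S S' : K → List Bool} {t : ℕ}
    (h : Runs p S t S') : ∑ k, (S' k).length ≤ ∑ k, (S k).length + t := by
  induction h with
  | push k b S => exact sum_length_update_le S (by simp)
  | pop k S => exact sum_length_update_le S (by simp only [List.length_tail]; omega)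
  | seq | ite_true | ite_false | loop_true | loop_false => omega

/-! ### The number of steps is partial recursive -/

/-- One round of the loop `loop k c p`, given the partial function `e` computed by `p`; the second
component counts the steps so far. -/
def loopStep (k : K) (c : Option Bool → Bool) (e : (K → List Bool) →. (K → List Bool) × ℕ)
    (a : (K → List Bool) × ℕ) : Part (((K → List Bool) × ℕ) ⊕ ((K → List Bool) × ℕ)) :=
  bif c (a.1 k).head? then (e a.1).map fun r => .inr (r.1, a.2 + (1 + r.2))
  else Part.some (.inl (a.1, a.2 + 1))

/-- The final stacks and the number of steps of a program. -/
def eval : StackProg K → (K → List Bool) →. (K → List Bool) × ℕ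
  | push k b => fun S => Part.some (Function.update S k (b :: S k), 1)
  | pop k => fun S => Part.some (Function.update S k (S k).tail, 1)
  | seq p q => fun S =>
    (p.eval S).bind fun r => (q.eval r.1).map fun r' => (r'.1, r.2 + r'.2)
  | ite k c p q => fun S =>
    (bif c (S k).head? then p.eval S else q.eval S).map fun r => (r.1, r.2 + 1)
  | loop k c p => fun S => PFun.fix (loopStep k c p.eval) (S, 0)

theorem Runs.mem_fix_loopStep {k : K} {c : Option Bool → Bool} {p : StackProg K}
    {e : (K → List Bool) →. (K → List Bool) × ℕ} (he : ∀ {S S' t}, Runs p S t S' → (S', t) ∈ e S)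
    {S S' : K → List Bool} {t : ℕ} (h : Runs (loop k c p) S t S') (a : ℕ) :
    (S', a + t) ∈ PFun.fix (loopStep k c e) (S, a) := by
  generalize hq : loop k c p = q at h
  induction h generalizing a with
  | push | pop | seq | ite_true | ite_false => cases hq
  | @loop_true _ _ _ S S₁ S₂ t₁ t₂ hc h₁ _ _ ih₂ =>
    cases hq
    refine PFun.mem_fix_iff.2 (Or.inr ⟨(S₁, a + (1 + t₁)), ?_, ?_⟩)
    · simp only [loopStep, hc, cond_true, Part.mem_map_iff]
      exact ⟨_, he h₁, rfl⟩
    · rw [← Nat.add_assoc a (1 + t₁) t₂]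
      exact ih₂ _ rfl
  | loop_false hc =>
    cases hq
    exact PFun.mem_fix_iff.2 (Or.inl (by simp [loopStep, hc]))

theorem Runs.mem_eval {p : StackProg K} {S S' : K → List Bool} {t : ℕ} (h : Runs p S t S') :
    (S', t) ∈ p.eval S := by
  induction p generalizing S S' t with
  | push k b => cases h; simp [eval]
  | pop k => cases h; simp [eval]
  | seq p q ihp ihq =>
    cases h with
    | seq h₁ h₂ =>
      simp only [eval, Part.mem_bind_iff, Part.mem_map_iff]
      exact ⟨_, ihp h₁, _, ihq h₂, rfl⟩
  | ite k c p q ihp ihq =>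
    cases h with
    | ite_true hc h =>
      simp only [eval, hc, cond_true, Part.mem_map_iff]
      exact ⟨_, ihp h, rfl⟩
    | ite_false hc h =>
      simp only [eval, hc, cond_false, Part.mem_map_iff]
      exact ⟨_, ihq h, rfl⟩
  | loop k c p ih => simpa only [eval, Nat.zero_add] using h.mem_fix_loopStep ih 0

section computability

variable {m : ℕ} (k : Fin m) (c : Option Bool → Bool)

theorem primrec_apply : Primrec fun S : Fin m → List Bool => S k :=
  Primrec.fin_app.comp Primrec.id (Primrec.const k)

theorem primrec_update :
    Primrec₂ fun (S : Fin m → List Bool) (l : List Bool) => Function.update S k l := by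
  refine Primrec.fin_curry.2 ?_
  have : Primrec fun a : ((Fin m → List Bool) × List Bool) × Fin m =>
      if a.2 = k then a.1.2 else a.1.1 a.2 :=
    Primrec.ite (Primrec.eq.comp Primrec.snd (Primrec.const k)) (Primrec.snd.comp Primrec.fst)
      (Primrec.fin_app.comp (Primrec.fst.comp Primrec.fst) Primrec.snd)
  exact this.of_eq fun a => by simp only [Function.update_apply]

theorem primrec_test : Primrec fun S : Fin m → List Bool => c (S k).head? :=
  (Primrec.dom_finite c).comp (Primrec.list_head?.comp (primrec_apply k))

theorem partrec_loopStep {e : (Fin m → List Bool) →. (Fin m → List Bool) × ℕ} (he : Partrec e) :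
    Partrec (loopStep k c e) := by
  refine Partrec.cond ((primrec_test k c).to_comp.comp Computable.fst) ?_ ?_
  · refine Partrec.map (he.comp Computable.fst) ?_
    refine Computable.sumInr.comp (Computable.pair (Computable.fst.comp Computable.snd) ?_)
    exact Primrec.nat_add.to_comp.comp (Computable.snd.comp Computable.fst)
      (Primrec.nat_add.to_comp.comp (Computable.const 1) (Computable.snd.comp Computable.snd))
  · exact (Computable.sumInl.comp (Computable.pair Computable.fst
      (Computable.succ.comp Computable.snd))).partrec

theorem partrec_eval (p : StackProg (Fin m)) : Partrec p.eval := by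
  induction p with
  | push k b =>
    exact (((primrec_update k).comp .id (Primrec.list_cons.comp (.const b)
      (primrec_apply k))).pair (.const 1)).to_comp.partrec
  | pop k =>
    exact (((primrec_update k).comp .id (Primrec.list_tail.comp (primrec_apply k))).pair
      (.const 1)).to_comp.partrec
  | seq p q ihp ihq =>
    refine ihp.bind (Partrec.map (ihq.comp (Computable.fst.comp Computable.snd)) ?_)
    exact Computable.pair (Computable.fst.comp Computable.snd)
      (Primrec.nat_add.to_comp.comp (Computable.snd.comp (Computable.snd.comp Computable.fst))
        (Computable.snd.comp Computable.snd))
  | ite k c p q ihp ihq =>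
    refine Partrec.map (Partrec.cond (primrec_test k c).to_comp ihp ihq) ?_
    exact Computable.pair (Computable.fst.comp Computable.snd)
      (Computable.succ.comp (Computable.snd.comp Computable.snd))
  | loop k c p ih =>
    exact (Partrec.fix (partrec_loopStep k c ih)).comp
      (Computable.pair Computable.id (Computable.const 0))

end computability

theorem computable_time {α : Type} [Primcodable α] {m : ℕ} {p : StackProg (Fin m)}
    {S S' : α → Fin m → List Bool} {t : α → ℕ} (hS : Computable S)
    (h : ∀ a, Runs p (S a) (t a) (S' a)) : Computable t := by
  have : Partrec fun a => (p.eval (S a)).map Prod.snd :=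
    Partrec.map ((partrec_eval p).comp hS) (Computable.snd.comp Computable.snd)
  exact this.of_eq fun a => by
    rw [Part.eq_some_iff.2 (h a).mem_eval, Part.map_some]; rfl

end StackProg

/-! ### Stack programs as Turing machines -/

namespace StackProg

variable {K : Type}

/-- The control points of a program. -/
def Label : StackProg K → Type
  | push _ _ => Unit
  | pop _ => Unit
  | seq p q => p.Label ⊕ q.Label
  | ite _ _ p q => Unit ⊕ (p.Label ⊕ q.Label)
  | loop _ _ p => Unit ⊕ p.Label

instance fintypeLabel : (p : StackProg K) → Fintype p.Label
  | push _ _ => inferInstanceAs (Fintype Unit)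
  | pop _ => inferInstanceAs (Fintype Unit)
  | seq p q =>
    have := fintypeLabel p
    have := fintypeLabel q
    inferInstanceAs (Fintype (p.Label ⊕ q.Label))
  | ite _ _ p q =>
    have := fintypeLabel p
    have := fintypeLabel q
    inferInstanceAs (Fintype (Unit ⊕ (p.Label ⊕ q.Label)))
  | loop _ _ p =>
    have := fintypeLabel p
    inferInstanceAs (Fintype (Unit ⊕ p.Label))

/-- The control point at which a program starts. -/
def entry : (p : StackProg K) → p.Label
  | push _ _ => ()
  | pop _ => ()
  | seq p _ => Sum.inl p.entry
  | ite _ _ _ _ => Sum.inl ()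
  | loop _ _ _ => Sum.inl ()

/-- Machine statements over the stacks `K`; the internal state holds the bit that was read last. -/
abbrev MachineStmt (K Λ : Type) := Turing.TM2.Stmt (fun _ : K => Bool) Λ (Option Bool)

/-- The configurations of machines with stacks `K`, labels `Λ` and statements `MachineStmt K Λ`. -/
abbrev MachineCfg (K Λ : Type) := Turing.TM2.Cfg (fun _ : K => Bool) Λ (Option Bool)

/-- Read the top of stack `k` and continue at `l₁` or at `l₂`, depending on the test `c`. -/
def branchOn {Λ : Type} (k : K) (c : Option Bool → Bool) (l₁ l₂ : Λ) : MachineStmt K Λ :=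
  .peek k (fun _ s => s) (.branch c (.goto fun _ => l₁) (.goto fun _ => l₂))

/-- The machine code of a program whose control points are embedded into the labels by `ι` and that
goes to the label `exit` in the end. -/
def code {Λ : Type} : (p : StackProg K) → (ι : p.Label → Λ) → (exit : Λ) → p.Label → MachineStmt K Λ
  | push k b, _, exit => fun _ => .push k (fun _ => b) (.goto fun _ => exit)
  | pop k, _, exit => fun _ => .pop k (fun _ s => s) (.goto fun _ => exit)
  | seq p q, ι, exit =>
    Sum.elim (p.code (fun l => ι (Sum.inl l)) (ι (Sum.inr q.entry)))
      (q.code (fun l => ι (Sum.inr l)) exit)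
  | ite k c p q, ι, exit =>
    Sum.elim (fun _ => branchOn k c (ι (Sum.inr (Sum.inl p.entry))) (ι (Sum.inr (Sum.inr q.entry))))
      (Sum.elim (p.code (fun l => ι (Sum.inr (Sum.inl l))) exit)
        (q.code (fun l => ι (Sum.inr (Sum.inr l))) exit))
  | loop k c p, ι, exit =>
    Sum.elim (fun _ => branchOn k c (ι (Sum.inr p.entry)) exit)
      (p.code (fun l => ι (Sum.inr l)) (ι (Sum.inl ())))

variable [DecidableEq K]

/-- The machine with the statements `M` goes from configuration `a` to `b` in exactly `t` steps. -/
def StepsTo {Λ : Type} (M : Λ → MachineStmt K Λ) (a : MachineCfg K Λ) (t : ℕ)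
    (b : MachineCfg K Λ) : Prop :=
  (flip bind (Turing.TM2.step M))^[t] (some a) = some b

section steps

variable {Λ : Type} {M : Λ → MachineStmt K Λ}

theorem StepsTo.trans {a b c : MachineCfg K Λ} {t u : ℕ} (h₁ : StepsTo M a t b)
    (h₂ : StepsTo M b u c) : StepsTo M a (t + u) c := by
  unfold StepsTo at *
  rw [Nat.add_comm, Function.iterate_add_apply, h₁, h₂]

theorem stepsTo_one {l : Λ} {s : MachineStmt K Λ} (hs : M l = s) (v : Option Bool)
    (S : K → List Bool) : StepsTo M ⟨some l, v, S⟩ 1 (Turing.TM2.stepAux s v S) := by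
  subst hs
  rfl

theorem stepsTo_branchOn {k : K} {c : Option Bool → Bool} {l l₁ l₂ : Λ}
    (hs : M l = branchOn k c l₁ l₂) (v : Option Bool) (S : K → List Bool) :
    StepsTo M ⟨some l, v, S⟩ 1 ⟨some (bif c (S k).head? then l₁ else l₂), (S k).head?, S⟩ := by
  have h := stepsTo_one hs v S
  cases hc : c (S k).head? <;>
    simpa only [branchOn, Turing.TM2.stepAux, hc, cond_true, cond_false] using h

theorem Runs.stepsTo {p : StackProg K} {S S' : K → List Bool} {t : ℕ} (h : Runs p S t S')
    (ι : p.Label → Λ) (exit : Λ) (hM : ∀ l, M (ι l) = p.code ι exit l) (v : Option Bool) :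
    ∃ v', StepsTo M ⟨some (ι p.entry), v, S⟩ t ⟨some exit, v', S'⟩ := by
  induction h generalizing exit v with
  | push k b S => exact ⟨_, stepsTo_one (hM ()) v S⟩
  | pop k S => exact ⟨_, stepsTo_one (hM ()) v S⟩
  | @seq p q _ _ _ _ _ _ _ ih₁ ih₂ =>
    obtain ⟨v₁, h₁⟩ := ih₁ (fun l => ι (Sum.inl l)) (ι (Sum.inr q.entry))
      (fun l => hM (Sum.inl l)) v
    obtain ⟨v₂, h₂⟩ := ih₂ (fun l => ι (Sum.inr l)) exit (fun l => hM (Sum.inr l)) v₁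
    exact ⟨v₂, h₁.trans h₂⟩
  | @ite_true k c p q S _ _ hc _ ih =>
    obtain ⟨v₁, h₁⟩ := ih (fun l => ι (Sum.inr (Sum.inl l))) exit
      (fun l => hM (Sum.inr (Sum.inl l))) (S k).head?
    have h := stepsTo_branchOn (hM (Sum.inl ())) v S
    rw [hc] at h
    exact ⟨v₁, Nat.add_comm 1 _ ▸ h.trans h₁⟩
  | @ite_false k c p q S _ _ hc _ ih =>
    obtain ⟨v₁, h₁⟩ := ih (fun l => ι (Sum.inr (Sum.inr l))) exit
      (fun l => hM (Sum.inr (Sum.inr l))) (S k).head?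
    have h := stepsTo_branchOn (hM (Sum.inl ())) v S
    rw [hc] at h
    exact ⟨v₁, Nat.add_comm 1 _ ▸ h.trans h₁⟩
  | @loop_true k c p S _ _ _ _ hc _ _ ih₁ ih₂ =>
    obtain ⟨v₁, h₁⟩ := ih₁ (fun l => ι (Sum.inr l)) (ι (Sum.inl ()))
      (fun l => hM (Sum.inr l)) (S k).head?
    obtain ⟨v₂, h₂⟩ := ih₂ ι exit hM v₁
    have h := stepsTo_branchOn (hM (Sum.inl ())) v S
    rw [hc] at h
    exact ⟨v₂, (h.trans h₁).trans h₂⟩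
  | @loop_false k c p S hc =>
    have h := stepsTo_branchOn (hM (Sum.inl ())) v S
    rw [hc] at h
    exact ⟨_, h⟩

end steps

variable [Fintype K]

/-- The machine that runs a program and halts, with input stack `k₀` and output stack `k₁`. Before
halting it resets its internal state, as `Turing.haltList` requires. -/
def machine (p : StackProg K) (k₀ k₁ : K) : Turing.FinTM2 where
  K := K
  k₀ := k₀
  k₁ := k₁
  Γ _ := Bool
  Λ := Option p.Label
  main := some p.entry
  σ := Option Bool
  initialState := none
  Γk₀Fin := inferInstanceAs (Fintype Bool)
  m
    | none => .load (fun _ => none) .halt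
    | some l => p.code some none l

/-- The machine of a program, with bits as input and output alphabet. -/
def computer (p : StackProg K) (k₀ k₁ : K) : Turing.TM2ComputableAux Bool Bool where
  tm := p.machine k₀ k₁
  inputAlphabet := Equiv.refl Bool
  outputAlphabet := Equiv.refl Bool

theorem initList_machine (p : StackProg K) (k₀ k₁ : K) (x : List Bool) :
    Turing.initList (p.machine k₀ k₁) x =
      (⟨some (some p.entry), none, Function.update (fun _ => []) k₀ x⟩ :
        MachineCfg K (Option p.Label)) :=
  congrArg (Turing.TM2.Cfg.mk (some (some p.entry)) none)
    (funext fun j => (Function.update_apply (fun _ => []) k₀ x j).symm)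

theorem haltList_machine (p : StackProg K) (k₀ k₁ : K) (y : List Bool) :
    Turing.haltList (p.machine k₀ k₁) y =
      (⟨none, none, Function.update (fun _ => []) k₁ y⟩ : MachineCfg K (Option p.Label)) :=
  congrArg (Turing.TM2.Cfg.mk none none)
    (funext fun j => (Function.update_apply (fun _ => []) k₁ y j).symm)

theorem RunsIn.outputsInTime {p : StackProg K} {k₀ k₁ : K} {x y : List Bool} {T : ℕ}
    (h : RunsIn p (Function.update (fun _ => []) k₀ x) T (Function.update (fun _ => []) k₁ y)) :
    Nonempty (Turing.TM2OutputsInTime (p.computer k₀ k₁).tm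
      (x.map (p.computer k₀ k₁).inputAlphabet.symm)
      (some (y.map (p.computer k₀ k₁).outputAlphabet.symm)) (T + 1)) := by
  obtain ⟨t, ht, hr⟩ := h
  obtain ⟨v, hrun⟩ := hr.stepsTo (M := (p.machine k₀ k₁).m) some none (fun _ => rfl) none
  have hhalt : StepsTo (p.machine k₀ k₁).m ⟨some none, v, Function.update (fun _ => []) k₁ y⟩ 1
      ⟨none, none, Function.update (fun _ => []) k₁ y⟩ := stepsTo_one rfl v _
  refine ⟨⟨⟨t + 1, ?_⟩, Nat.add_le_add_right ht 1⟩⟩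
  have hx : x.map (p.computer k₀ k₁).inputAlphabet.symm = x := List.map_id x
  have hy : y.map (p.computer k₀ k₁).outputAlphabet.symm = y := List.map_id y
  have hinit : Turing.initList (p.computer k₀ k₁).tm x = _ := initList_machine p k₀ k₁ x
  have hfinal : Turing.haltList (p.computer k₀ k₁).tm y = _ := haltList_machine p k₀ k₁ y
  rw [Option.map_some, hx, hy, hinit, hfinal]
  exact hrun.trans hhalt

end StackProg

/-! ### Moving unary numbers and lists of unary numbers between stacks -/

theorem replicate_append_encodeNat (n : ℕ) (A : List Bool) :
    List.replicate n true ++ false :: A = encodeNat n ++ A := by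
  induction n with
  | zero => rfl
  | succ n ih => simp only [List.replicate_succ, encodeNat, List.cons_append, ih]

namespace StackProg

variable {K : Type}

section leads

variable [DecidableEq K] {p q : StackProg K} {S S₁ S₂ : K → List Bool} {k : K}
  {c : Option Bool → Bool}

/-- `Leads p S S'`: started on the stacks `S`, the program `p` stops with the stacks `S'`. -/
def Leads (p : StackProg K) (S S' : K → List Bool) : Prop := ∃ t, Runs p S t S'

theorem Leads.congr (h : Leads p S S₁) (e : S₁ = S₂) : Leads p S S₂ := e ▸ h

theorem Leads.seq (h₁ : Leads p S S₁) (h₂ : Leads q S₁ S₂) : Leads (p ;; q) S S₂ :=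
  ⟨_, h₁.choose_spec.seq h₂.choose_spec⟩

theorem leads_push (k : K) (b : Bool) (S : K → List Bool) :
    Leads (.push k b) S (Function.update S k (b :: S k)) := ⟨_, .push k b S⟩

theorem leads_pop (k : K) (S : K → List Bool) :
    Leads (.pop k) S (Function.update S k (S k).tail) := ⟨_, .pop k S⟩

theorem Leads.ite_true (hc : c (S k).head? = true) (h : Leads p S S₁) :
    Leads (.ite k c p q) S S₁ := ⟨_, .ite_true hc h.choose_spec⟩

theorem Leads.ite_false (hc : c (S k).head? = false) (h : Leads q S S₁) :
    Leads (.ite k c p q) S S₁ := ⟨_, .ite_false hc h.choose_spec⟩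

theorem Leads.loop_true (hc : c (S k).head? = true) (h₁ : Leads p S S₁)
    (h₂ : Leads (.loop k c p) S₁ S₂) : Leads (.loop k c p) S S₂ :=
  ⟨_, .loop_true hc h₁.choose_spec h₂.choose_spec⟩

theorem Leads.loop_false (hc : c (S k).head? = false) : Leads (.loop k c p) S S :=
  ⟨_, .loop_false hc⟩

end leads

/-- The test whether the top of a stack is a `1`; it fails on the empty stack. -/
def isOne (o : Option Bool) : Bool := o == some true

section loops

variable [DecidableEq K] {a : K} {p : StackProg K}

theorem leads_loop_encodeNat (I : ℕ → ℕ → K → List Bool) (A : List Bool)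
    (hI : ∀ d n, I d n a = encodeNat n ++ A) (hp : ∀ d n, Leads p (I d (n + 1)) (I (d + 1) n))
    (n : ℕ) : Leads (.loop a isOne p) (I 0 n) (I n 0) := by
  suffices ∀ n d, Leads (.loop a isOne p) (I d n) (I (d + n) 0) by simpa using this n 0
  intro n
  induction n with
  | zero => exact fun d => .loop_false (by simp [hI, encodeNat, isOne])
  | succ n ih =>
    intro d
    refine .loop_true (by simp [hI, encodeNat, isOne]) (hp d n) ?_
    rw [← Nat.add_assoc, Nat.add_right_comm]
    exact ih (d + 1)

theorem leads_loop_encodeList {α : Type} (e : α → List Bool) (I : List α → List α → K → List Bool)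
    (A : List Bool) (hI : ∀ d l, I d l a = encodeList e l ++ A)
    (hp : ∀ d x l, Leads p (I d (x :: l)) (I (x :: d) l)) (l : List α) :
    Leads (.loop a isOne p) (I [] l) (I l.reverse []) := by
  suffices ∀ l d, Leads (.loop a isOne p) (I d l) (I (l.reverse ++ d) []) by simpa using this l []
  intro l
  induction l with
  | nil => exact fun d => .loop_false (by simp [hI, encodeList, isOne])
  | cons x l ih =>
    intro d
    refine .loop_true (by simp [hI, encodeList, isOne]) (hp d x l) ?_
    simpa using ih (x :: d)

end loops

/-- Do nothing, for two steps. The argument `a` is any stack. -/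
def skip (a : K) : StackProg K := .push a true ;; .pop a

/-- Push the bit `b` onto each of the stacks `ks`; the argument `a` is any stack. -/
def pushEach (a : K) (b : Bool) : List K → StackProg K
  | [] => skip a
  | k :: ks => .push k b ;; pushEach a b ks

/-- Move a unary number from stack `a` to each of the stacks `ks`. It is copied if there are several
of them, and deleted if there are none. -/
def moveNum (a : K) (ks : List K) : StackProg K :=
  pushEach a false ks ;; .loop a isOne (.pop a ;; pushEach a true ks) ;; .pop a

/-- Move a list of numbers from stack `a` to each of the stacks `ks`, reversing it. -/
def moveList (a : K) (ks : List K) : StackProg K :=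
  pushEach a false ks ;; .loop a isOne (.pop a ;; moveNum a ks ;; pushEach a true ks) ;; .pop a

/-- Remove the first number of the list on stack `a` and put it on stack `b`; if the list is empty,
put `0` on stack `b`. -/
def takeHead (a b : K) : StackProg K :=
  .ite a isOne (.pop a ;; moveNum a [b]) (.push b false)

section prepend

variable [DecidableEq K]

/-- The stacks `S` with the word `w` added on top of each of the stacks `ks`. -/
def prepend (ks : List K) (w : List Bool) (S : K → List Bool) : K → List Bool :=
  fun j => if j ∈ ks then w ++ S j else S j

variable {a b : K} {ks : List K} (w w' l : List Bool) (S : K → List Bool)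

@[simp]
theorem prepend_nil : prepend [] w S = S := by
  funext j
  simp [prepend]

@[simp]
theorem prepend_cons (hb : b ∉ ks) :
    prepend (b :: ks) w S = Function.update (prepend ks w S) b (w ++ S b) := by
  funext j
  by_cases hj : j = b
  · subst hj
    simp [prepend]
  · simp [prepend, hj]

@[simp]
theorem prepend_prepend : prepend ks w (prepend ks w' S) = prepend ks (w ++ w') S := by
  funext j
  by_cases hj : j ∈ ks <;> simp [prepend, hj]

theorem prepend_apply_of_notMem (ha : a ∉ ks) : prepend ks w S a = S a := by
  simp [prepend, ha]

theorem update_prepend (ha : a ∉ ks) :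
    Function.update (prepend ks w S) a l = prepend ks w (Function.update S a l) := by
  funext j
  by_cases hj : j = a
  · subst hj
    simp [prepend, ha]
  · simp [prepend, hj]

theorem runsIn_skip (a : K) (S : K → List Bool) : RunsIn (skip a) S 2 S :=
  ((runsIn_push a true S).seq (runsIn_pop a _)).congr le_rfl (by simp)

theorem leads_skip (a : K) (S : K → List Bool) : Leads (skip a) S S :=
  ⟨_, (runsIn_skip a S).choose_spec.2⟩

theorem leads_pushEach (a : K) (b : Bool) (hks : ks.Nodup) :
    Leads (pushEach a b ks) S (prepend ks [b] S) := by
  induction ks generalizing S with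
  | nil => exact (leads_skip a S).congr (prepend_nil _ S).symm
  | cons k ks ih =>
    obtain ⟨hk, hks⟩ := List.nodup_cons.1 hks
    refine (leads_push k b S).seq ((ih _ hks).congr ?_)
    rw [prepend_cons _ _ hk, ← update_prepend _ _ _ hk]
    rfl

variable {S}

theorem leads_moveNum (hks : ks.Nodup) (ha : a ∉ ks) (n : ℕ) {A : List Bool}
    (h : S a = encodeNat n ++ A) :
    Leads (moveNum a ks) S (prepend ks (encodeNat n) (Function.update S a A)) := by
  let I (d n : ℕ) : K → List Bool :=
    prepend ks (List.replicate d true ++ [false]) (Function.update S a (encodeNat n ++ A))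
  have hI : ∀ d n, I d n a = encodeNat n ++ A := fun d n => by
    simp [I, prepend_apply_of_notMem _ _ ha]
  have hstart : prepend ks [false] S = I 0 n := by simp [I, ← h]
  have hbody : ∀ d n, Leads (.pop a ;; pushEach a true ks) (I d (n + 1)) (I (d + 1) n) :=
    fun d n => (leads_pop _ _).seq ((leads_pushEach _ a true hks).congr
      (by simp [I, hI, encodeNat, update_prepend _ _ _ ha, List.replicate_succ]))
  refine ((leads_pushEach S a false hks).congr hstart).seq
    ((leads_loop_encodeNat I A hI hbody n).seq ((leads_pop _ _).congr ?_))
  have e : List.replicate n true ++ [false] = encodeNat n := by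
    simpa using replicate_append_encodeNat n []
  simp [I, hI, encodeNat, update_prepend _ _ _ ha, e]

theorem leads_moveList (hks : ks.Nodup) (ha : a ∉ ks) (l : List ℕ) {A : List Bool}
    (h : S a = encodeList encodeNat l ++ A) :
    Leads (moveList a ks) S
      (prepend ks (encodeList encodeNat l.reverse) (Function.update S a A)) := by
  let I (d l : List ℕ) : K → List Bool :=
    prepend ks (encodeList encodeNat d) (Function.update S a (encodeList encodeNat l ++ A))
  have hI : ∀ d l, I d l a = encodeList encodeNat l ++ A := fun d l => by
    simp [I, prepend_apply_of_notMem _ _ ha]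
  have hstart : prepend ks [false] S = I [] l := by simp [I, ← h, encodeList]
  have hbody : ∀ d x l, Leads (.pop a ;; moveNum a ks ;; pushEach a true ks) (I d (x :: l))
      (I (x :: d) l) := fun d x l =>
    (leads_pop _ _).seq ((leads_moveNum hks ha x (A := encodeList encodeNat l ++ A)
      (by simp [hI, encodeList])).seq ((leads_pushEach _ a true hks).congr
        (by simp [I, encodeList, update_prepend _ _ _ ha])))
  refine ((leads_pushEach S a false hks).congr hstart).seq
    ((leads_loop_encodeList encodeNat I A hI hbody l).seq ((leads_pop _ _).congr ?_))
  simp [I, hI, encodeList, update_prepend _ _ _ ha]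

theorem leads_takeHead (hab : a ≠ b) (l : List ℕ) {A : List Bool}
    (h : S a = encodeList encodeNat l ++ A) :
    Leads (takeHead a b) S (Function.update (Function.update S a
      (encodeList encodeNat l.tail ++ A)) b (encodeNat l.headI ++ S b)) := by
  cases l with
  | nil =>
    refine .ite_false (by simp [h, encodeList, isOne]) ((leads_push _ _ _).congr ?_)
    simp [h.symm, encodeNat, List.headI]
  | cons x l =>
    refine .ite_true (by simp [h, encodeList, isOne]) (((leads_pop _ _).seq
      (leads_moveNum (List.nodup_singleton b) (by simpa using hab) x
        (A := encodeList encodeNat l ++ A) (by simp [h, encodeList]))).congr ?_)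
    simp [hab.symm]

end prepend

end StackProg

/-! ### Running the codes of partial recursive functions -/

/-- Four stacks: a work stack, a store for numbers, a temporary stack and a stack of flags. -/
def quad (m s t c : List Bool) : Fin 4 → List Bool := ![m, s, t, c]

section quad

variable (m s t c x : List Bool)

@[simp] theorem quad_zero : quad m s t c 0 = m := rfl
@[simp] theorem quad_one : quad m s t c 1 = s := rfl
@[simp] theorem quad_two : quad m s t c 2 = t := rfl
@[simp] theorem quad_three : quad m s t c 3 = c := rfl

@[simp]
theorem update_quad_zero : Function.update (quad m s t c) 0 x = quad x s t c := by
  funext i; fin_cases i <;> rfl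

@[simp]
theorem update_quad_one : Function.update (quad m s t c) 1 x = quad m x t c := by
  funext i; fin_cases i <;> rfl

@[simp]
theorem update_quad_two : Function.update (quad m s t c) 2 x = quad m s x c := by
  funext i; fin_cases i <;> rfl

@[simp]
theorem update_quad_three : Function.update (quad m s t c) 3 x = quad m s t x := by
  funext i; fin_cases i <;> rfl

end quad

namespace StackProg

open Turing.ToPartrec

/-- Duplicate the list of numbers on the work stack. -/
def dupList : StackProg (Fin 4) :=
  moveList 0 [2] ;; moveList 2 [0, 1] ;; moveList 1 [2] ;; moveList 2 [0]

/-- One round of the iteration that runs the code `Code.fix f`, where `p` runs `f`; the flag tells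
whether there is another round. -/
def fixStep (p : StackProg (Fin 4)) : StackProg (Fin 4) :=
  .pop 3 ;; p ;; takeHead 0 1 ;; .ite 1 isOne (.push 3 true) (.push 3 false) ;; moveNum 1 []

/-- The program that runs the code of a partial recursive function on the list of numbers on the
work stack. -/
def ofCode : Code → StackProg (Fin 4)
  | .zero' => .push 0 false ;; .push 0 true
  | .succ => takeHead 0 1 ;; moveList 0 [] ;; .push 0 false ;; moveNum 1 [0] ;; .push 0 true ;;
      .push 0 true
  | .tail => takeHead 0 1 ;; moveNum 1 []
  | .cons f fs => dupList ;; ofCode f ;; takeHead 0 1 ;; moveList 0 [] ;; ofCode fs ;;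
      moveNum 1 [0] ;; .push 0 true
  | .comp f g => ofCode g ;; ofCode f
  | .case f g => takeHead 0 1 ;;
      .ite 1 isOne (.pop 1 ;; moveNum 1 [0] ;; .push 0 true ;; ofCode g) (.pop 1 ;; ofCode f)
  | .fix f => .push 3 true ;; .loop 3 isOne (fixStep (ofCode f)) ;; .pop 3

/-- The program `p` computes the partial function `f` on the list of numbers on top of the work
stack, whatever lies below that list and on the other stacks. -/
def Computes (p : StackProg (Fin 4)) (f : List ℕ →. List ℕ) : Prop :=
  ∀ ⦃v w⦄, w ∈ f v → ∀ A s t u : List Bool,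
    Leads p (quad (encodeList encodeNat v ++ A) s t u) (quad (encodeList encodeNat w ++ A) s t u)

section blocks

variable (n : ℕ) (v : List ℕ) (m A s t u : List Bool)

theorem leads_dupList : Leads dupList (quad (encodeList encodeNat v ++ A) s t u)
    (quad (encodeList encodeNat v ++ (encodeList encodeNat v ++ A)) s t u) := by
  refine Leads.seq (leads_moveList (by decide) (by decide) v (A := A) ?_)
    (Leads.seq (leads_moveList (by decide) (by decide) v.reverse (A := t) ?_)
      (Leads.seq (leads_moveList (by decide) (by decide) v (A := s) ?_)
        (Leads.congr (leads_moveList (by decide) (by decide) v.reverse (A := t) ?_) ?_)))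
  all_goals simp

theorem leads_takeHead_quad : Leads (takeHead 0 1) (quad (encodeList encodeNat v ++ A) s t u)
    (quad (encodeList encodeNat v.tail ++ A) (encodeNat v.headI ++ s) t u) :=
  Leads.congr (leads_takeHead (by decide) v (A := A) (by simp)) (by simp)

theorem leads_dropList_quad :
    Leads (moveList 0 []) (quad (encodeList encodeNat v ++ A) s t u) (quad A s t u) :=
  Leads.congr (leads_moveList List.nodup_nil List.not_mem_nil v (A := A) (by simp)) (by simp)

theorem leads_moveNum_quad : Leads (moveNum 1 [0]) (quad m (encodeNat n ++ s) t u)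
    (quad (encodeNat n ++ m) s t u) :=
  Leads.congr (leads_moveNum (by decide) (by decide) n (A := s) (by simp)) (by simp)

theorem leads_dropNum_quad :
    Leads (moveNum 1 []) (quad m (encodeNat n ++ s) t u) (quad m s t u) :=
  Leads.congr (leads_moveNum List.nodup_nil List.not_mem_nil n (A := s) (by simp)) (by simp)

end blocks

theorem computes_zero' : Computes (ofCode .zero') Code.zero'.eval := by
  intro v w h A s t u
  obtain rfl : w = 0 :: v := by simpa using h
  exact (leads_push _ _ _).seq ((leads_push _ _ _).congr (by simp [encodeList, encodeNat]))

theorem computes_succ : Computes (ofCode .succ) Code.succ.eval := by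
  intro v w h A s t u
  obtain rfl : w = [v.headI + 1] := by simpa using h
  refine (leads_takeHead_quad ..).seq ((leads_dropList_quad ..).seq ((leads_push ..).seq ?_))
  simp only [update_quad_zero, quad_zero]
  exact (leads_moveNum_quad ..).seq ((leads_push ..).seq ((leads_push ..).congr
    (by simp [encodeList, encodeNat])))

theorem computes_tail : Computes (ofCode .tail) Code.tail.eval := by
  intro v w h A s t u
  obtain rfl : w = v.tail := by simpa using h
  exact (leads_takeHead_quad ..).seq (leads_dropNum_quad ..)

section constructors

variable {f g : Code}

theorem computes_cons (hf : Computes (ofCode f) f.eval) (hg : Computes (ofCode g) g.eval) :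
    Computes (ofCode (.cons f g)) (Code.cons f g).eval := by
  intro v w h A s t u
  simp only [Code.cons_eval, Part.bind_eq_bind, Part.mem_bind_iff] at h
  obtain ⟨x, hx, y, hy, h⟩ := h
  obtain rfl : w = x.headI :: y := by simpa using h
  refine (leads_dupList ..).seq ((hf hx ..).seq ((leads_takeHead_quad ..).seq
    ((leads_dropList_quad ..).seq ((hg hy ..).seq ((leads_moveNum_quad ..).seq
      ((leads_push ..).congr ?_))))))
  simp [encodeList]

theorem computes_comp (hf : Computes (ofCode f) f.eval) (hg : Computes (ofCode g) g.eval) :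
    Computes (ofCode (.comp f g)) (Code.comp f g).eval := by
  intro v w h A s t u
  rw [Code.comp_eval] at h
  obtain ⟨x, hx, h⟩ := Part.mem_bind_iff.1 h
  exact (hg hx ..).seq (hf h ..)

theorem computes_case (hf : Computes (ofCode f) f.eval) (hg : Computes (ofCode g) g.eval) :
    Computes (ofCode (.case f g)) (Code.case f g).eval := by
  intro v w h A s t u
  simp only [Code.case_eval] at h
  refine (leads_takeHead_quad ..).seq ?_
  cases hv : v.headI with
  | zero =>
    rw [hv] at h
    refine .ite_false rfl ((leads_pop _ _).seq ?_)
    simpa [encodeNat] using hf h A s t u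
  | succ n =>
    rw [hv] at h
    refine .ite_true rfl ((leads_pop _ _).seq ?_)
    simp only [quad_one, encodeNat, List.cons_append, List.tail_cons, update_quad_one]
    refine (leads_moveNum_quad ..).seq ((leads_push _ _ _).seq ?_)
    simpa [encodeList] using hg h A s t u

theorem leads_fixStep {p : StackProg (Fin 4)} {F : List ℕ →. List ℕ} (hp : Computes p F)
    {v x : List ℕ} (hx : x ∈ F v) (A s t u : List Bool) (b : Bool) :
    Leads (fixStep p) (quad (encodeList encodeNat v ++ A) s t (b :: u))
      (quad (encodeList encodeNat x.tail ++ A) s t (decide (x.headI ≠ 0) :: u)) := by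
  refine (leads_pop _ _).seq ?_
  simp only [quad_three, List.tail_cons, update_quad_three]
  refine (hp hx ..).seq
    ((leads_takeHead_quad ..).seq (Leads.seq ?_ (leads_dropNum_quad x.headI ..)))
  cases x.headI with
  | zero => exact .ite_false rfl ((leads_push ..).congr (by simp))
  | succ n => exact .ite_true rfl ((leads_push ..).congr (by simp))

theorem computes_fix (hf : Computes (ofCode f) f.eval) :
    Computes (ofCode (.fix f)) (Code.fix f).eval := by
  intro v w h A s t u
  simp only [Code.fix_eval] at h
  have hloop : Leads (.loop 3 isOne (fixStep (ofCode f)))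
      (quad (encodeList encodeNat v ++ A) s t (true :: u))
      (quad (encodeList encodeNat w ++ A) s t (false :: u)) := by
    refine PFun.fixInduction' h ?_ ?_
    · intro v hv
      obtain ⟨x, hx, hv⟩ := (Part.mem_map_iff _).1 hv
      split_ifs at hv with h0
      obtain rfl := Sum.inl.inj hv
      refine .loop_true rfl (leads_fixStep hf hx ..) ?_
      simpa [h0] using Leads.loop_false rfl
    · intro v v' _ hv ih
      obtain ⟨x, hx, hv⟩ := (Part.mem_map_iff _).1 hv
      split_ifs at hv with h0
      obtain rfl := Sum.inr.inj hv
      refine .loop_true rfl (leads_fixStep hf hx ..) ?_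
      simpa [h0] using ih
  refine (leads_push _ _ _).seq ?_
  simp only [quad_three, update_quad_three]
  exact hloop.seq ((leads_pop _ _).congr (by simp))

end constructors

theorem computes_ofCode (c : Code) : Computes (ofCode c) c.eval := by
  induction c with
  | zero' => exact computes_zero'
  | succ => exact computes_succ
  | tail => exact computes_tail
  | cons f g hf hg => exact computes_cons hf hg
  | comp f g hf hg => exact computes_comp hf hg
  | case f g hf hg => exact computes_case hf hg
  | fix f hf => exact computes_fix hf

/-! ### Programs for computable lists of bits -/

/-- One round of the iteration that collects the values of `c` at `[n - 1, k], …, [0, k]`, where `n`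
is the first entry of the list and `k` the second one. -/
def collectStep (c : Code) : Code :=
  .case (Code.zero'.comp .tail)
    (.cons (Code.succ.comp .zero') (.cons .id (.cons .tail
      (.cons (c.comp (.cons .id (.cons .tail .nil))) (Code.tail.comp .tail)))))

theorem mem_eval_fix_collectStep {c : Code} {k : ℕ} {l : List ℕ}
    (hc : ∀ n, c.eval [n, k] = Part.some [l.getD n 0]) {j : ℕ} (hj : j ≤ l.length) :
    l ∈ (collectStep c).fix.eval (j :: k :: l.drop j) := by
  induction j with
  | zero =>
    rw [Code.fix_eval]
    exact PFun.mem_fix_iff.2 (Or.inl (by simp [collectStep]))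
  | succ j ih =>
    have hbind : (Part.some [j, k] >>= c.eval) = Part.some [l.getD j 0] := by
      rw [← hc]
      exact Part.bind_some _ _
    have hrec := ih (by omega)
    rw [Code.fix_eval] at hrec ⊢
    refine PFun.mem_fix_iff.2 (Or.inr ⟨_, ?_, hrec⟩)
    rw [List.drop_eq_getElem_cons hj]
    simp [collectStep, hbind, List.getElem?_eq_getElem hj]

theorem exists_code_list {F : ℕ → List ℕ} (hF : Computable F) :
    ∃ c : Code, ∀ k, F k ∈ c.eval [k] := by
  have hlen : Computable fun k => (F k).length := Computable.list_length.comp hF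
  have hget : Computable₂ fun n k => (F k).getD n 0 :=
    (Primrec.list_getD 0).to_comp.comp (hF.comp Computable.snd) Computable.fst
  obtain ⟨cl, hcl⟩ := Code.exists_code (Nat.Partrec'.part_iff₁.2 hlen.partrec)
  obtain ⟨cq, hcq⟩ := Code.exists_code (Nat.Partrec'.part_iff₂.2 hget.partrec₂)
  have hcl' : ∀ k, cl.eval [k] = Part.some [(F k).length] := fun k => by
    simpa [List.Vector.head] using hcl ⟨[k], rfl⟩
  have hcq' : ∀ k n, cq.eval [n, k] = Part.some [(F k).getD n 0] := fun k n => by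
    simpa [List.Vector.head, List.Vector.tail] using hcq ⟨[n, k], rfl⟩
  refine ⟨(collectStep cq).fix.comp (.cons cl .id), fun k => ?_⟩
  rw [Code.comp_eval]
  exact Part.mem_bind_iff.2 ⟨[(F k).length, k], by simp [hcl'],
    by simpa using mem_eval_fix_collectStep (hcq' k) le_rfl⟩

/-- Turn a list of numbers, each of them `0` or `1`, on the work stack into a list of bits on the
next stack, reversing it. -/
def unpackBits : StackProg (Fin 4) :=
  .loop 0 isOne (.pop 0 ;;
    .ite 0 isOne (.pop 0 ;; .pop 0 ;; .push 1 true) (.pop 0 ;; .push 1 false)) ;; .pop 0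

theorem leads_unpackBits (l : List Bool) :
    Leads unpackBits (quad (encodeList (fun b => encodeNat b.toNat) l) [] [] [])
      (quad [] l.reverse [] []) := by
  let e (b : Bool) : List Bool := encodeNat b.toNat
  refine (leads_loop_encodeList e (fun d l => quad (encodeList e l) d [] []) [] (by simp) ?_ l).seq
    ((leads_pop _ _).congr (by simp [encodeList]))
  intro d b l
  refine (leads_pop _ _).seq ?_
  cases b with
  | false => exact .ite_false rfl ((leads_pop ..).seq
      ((leads_push ..).congr (by simp [e, encodeList, encodeNat])))
  | true => exact .ite_true rfl ((leads_pop ..).seq ((leads_pop ..).seq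
      ((leads_push ..).congr (by simp [e, encodeList, encodeNat]))))

end StackProg

theorem encodeList_map {α β : Type} (e : β → List Bool) (f : α → β) (l : List α) :
    encodeList e (l.map f) = encodeList (fun a => e (f a)) l := by
  induction l with
  | nil => rfl
  | cons a l ih => simp [encodeList, ih]

theorem primrec_encodeNat : Primrec encodeNat := by
  have h : Primrec fun n : ℕ => (n.rec [false] fun _ l => true :: l : List Bool) :=
    Primrec.nat_rec₁ _ (Primrec.list_cons.comp (Primrec.const true) Primrec.snd)
  refine h.of_eq fun n => ?_
  induction n with
  | zero => rfl
  | succ n ih => simp only [encodeNat, ← ih]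

theorem primrec_quad_encodeList :
    Primrec fun k : ℕ => quad (encodeList encodeNat [k]) [] [] [] := by
  refine Primrec.fin_curry.2 ?_
  have h : Primrec fun a : ℕ × Fin 4 =>
      if a.2 = 0 then true :: (encodeNat a.1 ++ [false]) else [] :=
    Primrec.ite (Primrec.eq.comp Primrec.snd (Primrec.const 0))
      (Primrec.list_cons.comp (Primrec.const true)
        (Primrec.list_append.comp (primrec_encodeNat.comp Primrec.fst) (Primrec.const [false])))
      (Primrec.const [])
  refine h.of_eq ?_
  rintro ⟨k, i⟩
  fin_cases i <;> rfl

theorem exists_prog_computable_time {F : ℕ → List Bool} (hF : Computable F) :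
    ∃ (p : StackProg (Fin 4)) (t : ℕ → ℕ), Computable t ∧ ∀ k,
      StackProg.Runs p (quad (encodeList encodeNat [k]) [] [] []) (t k) (quad [] (F k) [] []) := by
  obtain ⟨c, hc⟩ := StackProg.exists_code_list (F := fun k => (F k).reverse.map Bool.toNat)
    ((Primrec.list_map Primrec.list_reverse
      ((Primrec.dom_finite Bool.toNat).comp Primrec.snd).to₂).to_comp.comp hF)
  have h : ∀ k, StackProg.Leads (StackProg.ofCode c ;; StackProg.unpackBits)
      (quad (encodeList encodeNat [k]) [] [] []) (quad [] (F k) [] []) := fun k => by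
    have hcode := StackProg.computes_ofCode c (hc k) [] [] [] []
    rw [encodeList_map] at hcode
    exact .seq (by simpa using hcode)
      ((StackProg.leads_unpackBits (F k).reverse).congr (by simp))
  choose t ht using h
  exact ⟨_, t, StackProg.computable_time primrec_quad_encodeList.to_comp ht, ht⟩

/-! ### Clause templates -/

/-- A set of kinds, where a choice of a vertex, or of no vertex, is of one of three kinds relative
to a vertex `v`: it is `v` itself (kind `0`), a neighbour of `v` (kind `1`), or neither (kind `2`).
A list of `k` masks is a template: together with a vertex it describes a clause. -/
abbrev Mask := Fin 3 → Bool

/-- The binary code of a mask. -/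
def encodeMask (m : Mask) : List Bool := [m 0, m 1, m 2]

/-- All sequences of `k` kinds. -/
def patterns : ℕ → List (List (Fin 3))
  | 0 => [[]]
  | k + 1 => (patterns k).flatMap fun b => [0 :: b, 1 :: b, 2 :: b]

/-- A vertex may see choices of the kinds `b`; `s` and `r` are the first values of the
characteristic functions of `σ` and `ρ`. -/
def allowed (s r : List Bool) (b : List (Fin 3)) : Bool :=
  if b.count 0 = 0 then r.getD (b.count 1) false
  else if b.count 0 = 1 then s.getD (b.count 1) false else false

/-- The template that rules out the sequence of kinds `b`. -/
def avoid (b : List (Fin 3)) : List Mask := b.map fun τ κ => decide (κ ≠ τ)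

/-- The template that demands that the `i`-th of `k` choices is made. -/
def demand (k i : ℕ) : List Mask := (List.range k).map fun j _ => decide (j = i)

/-- The templates that express that all the choices are made and that no vertex sees choices that
are not allowed. -/
def templatesOf (s r : List Bool) (k : ℕ) : List (List Mask) :=
  (List.range k).map (demand k) ++
    (patterns k).filterMap fun b => if allowed s r b then none else some (avoid b)

/-- The first `k + 1` values of a function. -/
def table (χ : ℕ → Bool) (k : ℕ) : List Bool := (List.range (k + 1)).map χ

/-- The templates for the sets with the characteristic functions `χσ` and `χρ`. -/
def templates (χσ χρ : ℕ → Bool) (k : ℕ) : List (List Mask) :=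
  templatesOf (table χσ k) (table χρ k) k

/-- The templates as a binary word. -/
def templateBits (χσ χρ : ℕ → Bool) (k : ℕ) : List Bool :=
  (templates χσ χρ k).flatMap (encodeList encodeMask)

theorem mem_patterns {k : ℕ} {b : List (Fin 3)} : b ∈ patterns k ↔ b.length = k := by
  induction k generalizing b with
  | zero => simp [patterns]
  | succ k ih =>
    simp only [patterns, List.mem_flatMap, ih]
    constructor
    · rintro ⟨l, rfl, h⟩
      simp only [List.mem_cons, List.not_mem_nil, or_false] at h
      rcases h with rfl | rfl | rfl <;> simp
    · intro h
      obtain ⟨τ, l, rfl⟩ := List.exists_cons_of_length_eq_add_one h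
      refine ⟨l, by simpa using h, ?_⟩
      fin_cases τ <;> simp

theorem encodeList_eq_flatMap {α : Type} (e : α → List Bool) (l : List α) :
    encodeList e l = (l.flatMap fun a => true :: e a) ++ [false] := by
  induction l with
  | nil => rfl
  | cons a l ih => simp [encodeList, ih]

theorem primrec_patterns : Primrec patterns := by
  have h : Primrec fun k : ℕ => (k.rec [[]] fun _ L =>
      L.flatMap fun b => [0 :: b, 1 :: b, 2 :: b] : List (List (Fin 3))) := by
    refine Primrec.nat_rec₁ _ (Primrec.list_flatMap Primrec.snd ?_)
    have hcons (τ : Fin 3) :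
        Primrec fun a : (ℕ × List (List (Fin 3))) × List (Fin 3) => τ :: a.2 :=
      Primrec.list_cons.comp (Primrec.const τ) Primrec.snd
    exact Primrec.list_cons.comp (hcons 0) (Primrec.list_cons.comp (hcons 1)
      (Primrec.list_cons.comp (hcons 2) (Primrec.const [])))
  refine h.of_eq fun k => ?_
  induction k with
  | zero => rfl
  | succ k ih => simp only [patterns, ← ih]

theorem primrec_count {α : Type*} [Primcodable α] [DecidableEq α] (a : α) :
    Primrec fun l : List α => l.count a := by
  have h : Primrec fun l : List α => (l.filter fun x => decide (x = a)).length :=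
    Primrec.list_length.comp (Primrec.listFilter (Primrec.eq.comp Primrec.id (Primrec.const a)))
  refine h.of_eq fun l => ?_
  rw [List.count_eq_countP, List.countP_eq_length_filter]
  rfl

theorem primrec_avoid : Primrec avoid := by
  have h : Primrec fun τ : Fin 3 => (fun κ => decide (κ ≠ τ) : Mask) := Primrec.dom_finite _
  exact Primrec.list_map Primrec.id (h.comp Primrec.snd).to₂

theorem primrec_demand : Primrec₂ demand := by
  refine Primrec.list_map (Primrec.list_range.comp Primrec.fst) (Primrec.fin_curry.2 ?_)
  have h : Primrec fun a : ((ℕ × ℕ) × ℕ) × Fin 3 => decide (a.1.2 = a.1.1.2) :=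
    (Primrec.eq (α := ℕ)).decide.comp (Primrec.snd.comp Primrec.fst)
      (Primrec.snd.comp (Primrec.fst.comp Primrec.fst))
  exact h

theorem primrec_allowed :
    Primrec fun a : (List Bool × List Bool) × List (Fin 3) => allowed a.1.1 a.1.2 a.2 := by
  have hcount (τ : Fin 3) :
      Primrec fun a : (List Bool × List Bool) × List (Fin 3) => a.2.count τ :=
    (primrec_count τ).comp Primrec.snd
  exact Primrec.ite (Primrec.eq.comp (hcount 0) (Primrec.const 0))
    ((Primrec.list_getD false).comp (Primrec.snd.comp Primrec.fst) (hcount 1))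
    (Primrec.ite (Primrec.eq.comp (hcount 0) (Primrec.const 1))
      ((Primrec.list_getD false).comp (Primrec.fst.comp Primrec.fst) (hcount 1))
      (Primrec.const false))

theorem primrec_templatesOf :
    Primrec fun a : (List Bool × List Bool) × ℕ => templatesOf a.1.1 a.1.2 a.2 := by
  refine Primrec.list_append.comp ?_ ?_
  · exact Primrec.list_map (Primrec.list_range.comp Primrec.snd)
      (primrec_demand.comp (Primrec.snd.comp Primrec.fst) Primrec.snd)
  · refine Primrec.listFilterMap (primrec_patterns.comp Primrec.snd) (Primrec.ite
      (Primrec.eq.comp ?_ (Primrec.const true)) (Primrec.const none)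
      (Primrec.option_some.comp (primrec_avoid.comp Primrec.snd)))
    exact primrec_allowed.comp (Primrec.pair (Primrec.fst.comp Primrec.fst) Primrec.snd)

theorem computable_table {χ : ℕ → Bool} (hχ : Computable χ) : Computable (table χ) := by
  have hstep : Computable₂ fun (_ : ℕ) (a : ℕ × List Bool) => a.2 ++ [χ a.1] :=
    Computable.list_concat.comp (Computable.snd.comp Computable.snd)
      (hχ.comp (Computable.fst.comp Computable.snd))
  have h := Computable.nat_rec Computable.succ (Computable.const ([] : List Bool)) hstep
  refine h.of_eq fun k => ?_
  rw [table, ← Nat.succ_eq_add_one]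
  generalize k.succ = m
  induction m with
  | zero => rfl
  | succ m ih => simp only [List.range_succ, List.map_append, ← ih, List.map_cons, List.map_nil]

theorem primrec_encodeList {α : Type} [Primcodable α] {e : α → List Bool} (he : Primrec e) :
    Primrec (encodeList e) := by
  have h : Primrec fun l : List α => (l.flatMap fun a => true :: e a) ++ [false] :=
    Primrec.list_append.comp (Primrec.list_flatMap Primrec.id
      (Primrec.list_cons.comp (Primrec.const true) (he.comp Primrec.snd)).to₂)
      (Primrec.const [false])
  exact h.of_eq fun l => (encodeList_eq_flatMap e l).symm

theorem computable_templateBits {χσ χρ : ℕ → Bool} (hσ : Computable χσ) (hρ : Computable χρ) :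
    Computable (templateBits χσ χρ) := by
  have h : Primrec fun a : (List Bool × List Bool) × ℕ =>
      (templatesOf a.1.1 a.1.2 a.2).flatMap (encodeList encodeMask) :=
    Primrec.list_flatMap primrec_templatesOf
      ((primrec_encodeList (Primrec.dom_finite encodeMask)).comp Primrec.snd).to₂
  exact h.to_comp.comp (((computable_table hσ).pair (computable_table hρ)).pair Computable.id)

/-! ### Monotone formulas in conjunctive normal form as circuits -/

theorem forall_mem_range'_getD_append {β : Type} {p : β → Prop}
    (vals l : List β) (d : β) :
    (∀ a ∈ List.range' vals.length l.length, p ((vals ++ l).getD a d)) ↔ ∀ b ∈ l, p b := by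
  simp only [List.forall_mem_iff_getElem, List.length_range', List.getElem_range', one_mul]
  refine forall₂_congr fun i hi => ?_
  rw [List.getD_append_right _ _ _ _ (Nat.le_add_right _ _), Nat.add_sub_cancel_left,
    List.getD_eq_getElem _ _ hi]

section cnf

variable {β : Type} [Inhabited β]

/-- The value that `step` gives to a gate depends only on the values of the nodes that feed it. -/
def DependsOnArgs (step : (ℕ → β) → Gate → β) : Prop :=
  ∀ v w g, (∀ a ∈ g.args, v a = w a) → step v g = step w g

theorem Gate.maxArg_le {d : ℕ → ℕ} {g : Gate} {B : ℕ} (h : ∀ a ∈ g.args, d a ≤ B) :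
    g.maxArg d ≤ B := by
  unfold Gate.maxArg
  generalize g.args = l at h
  induction l with
  | nil => simp
  | cons a l ih =>
    simp only [List.map_cons, List.foldr_cons, max_le_iff]
    exact ⟨h a (by simp), ih fun b hb => h b (by simp [hb])⟩

theorem dependsOnArgs_add_maxArg (c : Gate → ℕ) :
    DependsOnArgs fun d g => c g + g.maxArg d := by
  intro v w g h
  simp only [Gate.maxArg, List.map_congr_left h]

theorem dependsOnArgs_eval : DependsOnArgs Gate.eval := by
  intro v w g h
  rw [Bool.eq_iff_iff]
  cases g with
  | not a => simp [Gate.eval, h a (by simp [Gate.args])]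
  | and as =>
    simp only [Gate.eval, List.all_eq_true]
    exact forall₂_congr fun a ha => by rw [h a ha]
  | or as =>
    simp only [Gate.eval, List.any_eq_true]
    exact exists_congr fun a => and_congr_right fun ha => by rw [h a ha]

/-- The gates of the conjunction of the clauses `cls` in `N` variables: one disjunction for each
clause, and the conjunction of all of them. -/
def cnfGates (N : ℕ) (cls : List (List ℕ)) : List Gate :=
  cls.map Gate.or ++ [Gate.and (List.range' N cls.length)]

/-- The circuit of the conjunction of the clauses `cls` in the variables below `N`. -/
def cnfCircuit (N : ℕ) (cls : List (List ℕ)) (h : ∀ cl ∈ cls, ∀ a ∈ cl, a < N) : Circuit where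
  numInputs := N
  gates := cnfGates N cls
  output := N + cls.length
  args_lt := by
    intro i hi a ha
    by_cases hi' : i < cls.length
    · simp only [cnfGates, List.getElem_append_left (show i < (cls.map Gate.or).length by simpa),
        List.getElem_map] at ha
      exact (h _ (List.getElem_mem _) a ha).trans_le (Nat.le_add_right _ _)
    · obtain rfl : i = cls.length := by
        simp only [cnfGates, List.length_append, List.length_map, List.length_cons,
          List.length_nil] at hi
        omega
      have ha : N ≤ a ∧ a < N + cls.length := by simpa [cnfGates, Gate.args] using ha
      exact ha.2
  output_lt := by simp [cnfGates]

variable {step : (ℕ → β) → Gate → β} {vals : List β} {cls : List (List ℕ)}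

theorem runGates_map_or_append (hstep : DependsOnArgs step)
    (h : ∀ cl ∈ cls, ∀ a ∈ cl, a < vals.length) (w : List β) (gs : List Gate) :
    runGates step (vals ++ w) (cls.map Gate.or ++ gs) =
      runGates step
        (vals ++ (w ++ cls.map fun cl => step (fun i => vals.getD i default) (.or cl))) gs := by
  induction cls generalizing w with
  | nil => simp
  | cons cl cls ih =>
    have hcl : step (fun i => (vals ++ w).getD i default) (.or cl) =
        step (fun i => vals.getD i default) (.or cl) := by
      refine hstep _ _ _ fun a ha => ?_
      have ha : a < vals.length := h cl (by simp) a ha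
      simp [List.getElem?_append_left ha]
    simp only [List.map_cons, List.cons_append, runGates]
    rw [hcl, List.append_assoc, ih (fun c hc => h c (by simp [hc]))]
    simp

theorem getD_runGates_cnfGates (hstep : DependsOnArgs step)
    (h : ∀ cl ∈ cls, ∀ a ∈ cl, a < vals.length) (d : β) :
    (runGates step vals (cnfGates vals.length cls)).getD (vals.length + cls.length) d =
      step (fun i => (vals ++ cls.map fun cl =>
        step (fun i => vals.getD i default) (.or cl)).getD i default)
        (.and (List.range' vals.length cls.length)) := by
  have hrun := runGates_map_or_append hstep h [] [Gate.and (List.range' vals.length cls.length)]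
  rw [List.append_nil, List.nil_append] at hrun
  rw [cnfGates, hrun, runGates, runGates, List.getD_append_right _ _ _ _ (by simp)]
  simp

end cnf

section cnfCircuit

variable {N : ℕ} {cls : List (List ℕ)} (h : ∀ cl ∈ cls, ∀ a ∈ cl, a < N)

include h in
theorem getD_runGates_add_maxArg_le {c : Gate → ℕ} (hc : ∀ g, c g ≤ 1) :
    (runGates (fun d g => c g + g.maxArg d) (List.replicate N 0) (cnfGates N cls)).getD
      (N + cls.length) 0 ≤ 2 := by
  have hrun := getD_runGates_cnfGates (dependsOnArgs_add_maxArg c) (vals := List.replicate N 0)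
    (by simpa using h) 0
  rw [List.length_replicate] at hrun
  rw [hrun]
  refine Nat.add_le_add (b := 1) (d := 1) (hc _) (Gate.maxArg_le ?_)
  have hor := forall_mem_range'_getD_append (p := fun d => d ≤ 1) (List.replicate N 0)
    (cls.map fun cl =>
      c (.or cl) + (Gate.or cl).maxArg fun i => (List.replicate N 0).getD i default) default
  rw [List.length_map, List.length_replicate, List.forall_mem_map] at hor
  refine hor.2 fun cl hcl => Nat.add_le_add (d := 0) (hc _) (Gate.maxArg_le fun a ha => ?_)
  simp [h cl hcl a ha]

theorem cnfCircuit_depth_le : (cnfCircuit N cls h).depth ≤ 2 :=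
  getD_runGates_add_maxArg_le (c := fun _ => 1) h fun _ => le_rfl

theorem cnfCircuit_weft_le : (cnfCircuit N cls h).weft ≤ 2 :=
  getD_runGates_add_maxArg_le (c := fun g => if g.isLarge then 1 else 0) h fun g => by
    split_ifs <;> simp

theorem cnfCircuit_eval (x : Fin N → Bool) : (cnfCircuit N cls h).eval x = true ↔
    ∀ cl ∈ cls, ∃ a : Fin N, (a : ℕ) ∈ cl ∧ x a = true := by
  have hrun := getD_runGates_cnfGates dependsOnArgs_eval (vals := List.ofFn x)
    (by simpa using h) false
  have hand := forall_mem_range'_getD_append (p := fun b => b = true) (List.ofFn x)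
    (cls.map fun cl => Gate.eval (fun i => (List.ofFn x).getD i default) (.or cl)) default
  simp only [List.length_map, List.length_ofFn] at hrun hand
  change (runGates Gate.eval (List.ofFn x) (cnfGates N cls)).getD (N + cls.length) false = true ↔ _
  rw [hrun]
  simp only [Gate.eval, List.all_eq_true] at hand ⊢
  rw [hand, List.forall_mem_map]
  simp only [List.any_eq_true]
  refine forall₂_congr fun cl hcl => ⟨?_, ?_⟩
  · rintro ⟨a, ha, hx⟩
    have haN := h cl hcl a ha
    exact ⟨⟨a, haN⟩, ha, by simpa [haN] using hx⟩
  · rintro ⟨a, ha, hx⟩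
    exact ⟨a, ha, by simpa using hx⟩

end cnfCircuit

/-! ### The clauses of a graph -/

/-- The variables of one vertex that a template selects: the vertex has the kind `τ`, and its
variables are numbered from `c` on. -/
def slotArgs (τ : Fin 3) : ℕ → List Mask → List ℕ
  | _, [] => []
  | c, m :: ms => if m τ then c :: slotArgs τ (c + 1) ms else slotArgs τ (c + 1) ms

/-- The variables that a template selects, given the kinds of all the vertices in a row. -/
def clauseArgs (tpl : List Mask) : ℕ → List (Fin 3) → List ℕ
  | _, [] => []
  | c, τ :: row => slotArgs τ c tpl ++ clauseArgs tpl (c + tpl.length) row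

/-- The clauses given by all templates and rows. -/
def clauses (tpls : List (List Mask)) (rows : List (List (Fin 3))) : List (List ℕ) :=
  tpls.flatMap fun tpl => rows.map (clauseArgs tpl 0)

open Classical in
/-- The kind of a choice relative to the vertex `v`; the choice `n` stands for no vertex. -/
noncomputable def kind {n : ℕ} (G : SimpleGraph (Fin n)) (v : Fin n) (p : Fin (n + 1)) : Fin 3 :=
  if p = v.castSucc then 0 else if ∃ u, p = u.castSucc ∧ G.Adj v u then 1 else 2

/-- For each vertex the kinds of all choices relative to it. -/
noncomputable def rows {n : ℕ} (G : SimpleGraph (Fin n)) : List (List (Fin 3)) :=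
  (List.finRange n).map fun v => List.ofFn (kind G v)

theorem mem_slotArgs {τ : Fin 3} {c a : ℕ} {tpl : List Mask} :
    a ∈ slotArgs τ c tpl ↔ ∃ i m, tpl[i]? = some m ∧ m τ = true ∧ a = c + i := by
  induction tpl generalizing c with
  | nil => simp [slotArgs]
  | cons m ms ih =>
    have hs : a ∈ slotArgs τ c (m :: ms) ↔ (m τ = true ∧ a = c) ∨ a ∈ slotArgs τ (c + 1) ms := by
      by_cases h : m τ = true <;> simp [slotArgs, h]
    rw [hs, ih]
    constructor
    · rintro (⟨h, rfl⟩ | ⟨i, m', h₁, h₂, rfl⟩)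
      · exact ⟨0, m, by simp, h, by simp⟩
      · exact ⟨i + 1, m', by simpa using h₁, h₂, by omega⟩
    · rintro ⟨_ | i, m', h₁, h₂, rfl⟩
      · simp only [List.getElem?_cons_zero, Option.some.injEq] at h₁
        exact Or.inl ⟨h₁ ▸ h₂, rfl⟩
      · exact Or.inr ⟨i, m', by simpa using h₁, h₂, by omega⟩

theorem mem_clauseArgs {tpl : List Mask} {c a : ℕ} {row : List (Fin 3)} :
    a ∈ clauseArgs tpl c row ↔ ∃ p i τ m, row[p]? = some τ ∧ tpl[i]? = some m ∧ m τ = true ∧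
      a = c + (i + tpl.length * p) := by
  induction row generalizing c with
  | nil => simp [clauseArgs]
  | cons τ row ih =>
    rw [clauseArgs, List.mem_append, ih, mem_slotArgs]
    constructor
    · rintro (⟨i, m, h₁, h₂, rfl⟩ | ⟨p, i, τ', m, h₁, h₂, h₃, rfl⟩)
      · exact ⟨0, i, τ, m, by simp, h₁, h₂, by simp⟩
      · exact ⟨p + 1, i, τ', m, by simpa using h₁, h₂, h₃, by ring⟩
    · rintro ⟨_ | p, i, τ', m, h₁, h₂, h₃, rfl⟩
      · simp only [List.getElem?_cons_zero, Option.some.injEq] at h₁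
        exact Or.inl ⟨i, m, h₂, h₁ ▸ h₃, by simp⟩
      · exact Or.inr ⟨p, i, τ', m, by simpa using h₁, h₂, h₃, by ring⟩

theorem mem_templatesOf {s r : List Bool} {k : ℕ} {tpl : List Mask} :
    tpl ∈ templatesOf s r k ↔ (∃ i : Fin k, demand k i = tpl) ∨
      ∃ b : Fin k → Fin 3, allowed s r (List.ofFn b) = false ∧ avoid (List.ofFn b) = tpl := by
  simp only [templatesOf, List.mem_append, List.mem_map, List.mem_range, List.mem_filterMap,
    mem_patterns]
  refine or_congr ⟨fun ⟨i, hi, h⟩ => ⟨⟨i, hi⟩, h⟩, fun ⟨i, h⟩ => ⟨i, i.2, h⟩⟩ ⟨?_, ?_⟩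
  · rintro ⟨b, rfl, h⟩
    split_ifs at h with hb
    exact ⟨b.get, by simpa [List.ofFn_get] using hb, by simpa [List.ofFn_get] using h⟩
  · rintro ⟨b, hb, h⟩
    exact ⟨List.ofFn b, List.length_ofFn, by simp [hb, h]⟩

theorem length_of_mem_templatesOf {s r : List Bool} {k : ℕ} {tpl : List Mask}
    (h : tpl ∈ templatesOf s r k) : tpl.length = k := by
  rcases mem_templatesOf.1 h with ⟨i, rfl⟩ | ⟨b, -, rfl⟩
  · simp [demand]
  · simp [avoid]

section clauses

variable {s r : List Bool} {k n : ℕ} {G : SimpleGraph (Fin n)}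

theorem mem_clauses_rows {tpls : List (List Mask)} {cl : List ℕ} :
    cl ∈ clauses tpls (rows G) ↔
      ∃ tpl ∈ tpls, ∃ v, clauseArgs tpl 0 (List.ofFn (kind G v)) = cl := by
  simp [clauses, rows]

theorem lt_of_mem_clauses :
    ∀ cl ∈ clauses (templatesOf s r k) (rows G), ∀ a ∈ cl, a < (n + 1) * k := by
  intro cl hcl a ha
  obtain ⟨tpl, htpl, v, rfl⟩ := mem_clauses_rows.1 hcl
  obtain ⟨p, i, τ, m, hp, hi, -, rfl⟩ := mem_clauseArgs.1 ha
  have hk := length_of_mem_templatesOf htpl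
  have hp := (List.getElem?_eq_some_iff.1 hp).1
  have hi := (List.getElem?_eq_some_iff.1 hi).1
  rw [List.length_ofFn] at hp
  rw [hk] at hi ⊢
  calc 0 + (i + k * p) < k + k * p := by omega
    _ = (p + 1) * k := by ring
    _ ≤ (n + 1) * k := Nat.mul_le_mul_right k hp

theorem exists_mem_clauseArgs_iff {tpl : List Mask} (htpl : tpl.length = k) (v : Fin n)
    (x : Fin ((n + 1) * k) → Bool) :
    (∃ a : Fin ((n + 1) * k), (a : ℕ) ∈ clauseArgs tpl 0 (List.ofFn (kind G v)) ∧ x a = true) ↔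
      ∃ (p : Fin (n + 1)) (i : Fin k), x (finProdFinEquiv (p, i)) = true ∧
        tpl[(i : ℕ)] (kind G v p) = true := by
  subst htpl
  constructor
  · rintro ⟨a, ha, hx⟩
    obtain ⟨p, i, τ, m, hp, hi, hm, e⟩ := mem_clauseArgs.1 ha
    obtain ⟨hp', rfl⟩ := List.getElem?_eq_some_iff.1 hp
    obtain ⟨hi', rfl⟩ := List.getElem?_eq_some_iff.1 hi
    refine ⟨⟨p, by simpa using hp'⟩, ⟨i, hi'⟩, ?_, by rwa [List.getElem_ofFn] at hm⟩
    convert hx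
    ext
    simp [e]
  · rintro ⟨p, i, hx, hm⟩
    refine ⟨_, mem_clauseArgs.2 ⟨p, i, kind G v p, tpl[(i : ℕ)],
      by rw [List.getElem?_eq_getElem (by simp; omega), List.getElem_ofFn], by simp, hm, ?_⟩, hx⟩
    simp

theorem getElem_demand {i j : ℕ} (h : j < (demand k i).length) :
    (demand k i)[j] = fun _ => decide (j = i) := by
  simp [demand]

theorem getElem_avoid {b : List (Fin 3)} {j : ℕ} (h : j < (avoid b).length) :
    (avoid b)[j] = fun κ => decide (κ ≠ b[j]'(by simpa [avoid] using h)) := by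
  simp [avoid]

theorem forall_clauses_iff (x : Fin ((n + 1) * k) → Bool) :
    (∀ cl ∈ clauses (templatesOf s r k) (rows G), ∃ a : Fin ((n + 1) * k),
      (a : ℕ) ∈ cl ∧ x a = true) ↔
    ∀ v, (∀ i, ∃ p, x (finProdFinEquiv (p, i)) = true) ∧
      ∀ b : Fin k → Fin 3, allowed s r (List.ofFn b) = false →
        ∃ p i, x (finProdFinEquiv (p, i)) = true ∧ kind G v p ≠ b i := by
  have hdemand (v : Fin n) (i : Fin k) := exists_mem_clauseArgs_iff (G := G)
    (show (demand k i).length = k by simp [demand]) v x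
  have havoid (v : Fin n) (b : Fin k → Fin 3) := exists_mem_clauseArgs_iff (G := G)
    (show (avoid (List.ofFn b)).length = k by simp [avoid]) v x
  simp only [getElem_demand, decide_eq_true_eq, ← Fin.ext_iff, exists_eq_right] at hdemand
  simp only [getElem_avoid, List.getElem_ofFn, Fin.eta, decide_eq_true_eq] at havoid
  constructor
  · intro h v
    refine ⟨fun i => ?_, fun b hb => (havoid v b).1 (h _ (mem_clauses_rows.2
      ⟨_, mem_templatesOf.2 (Or.inr ⟨b, hb, rfl⟩), v, rfl⟩))⟩
    exact (hdemand v i).1 (h _ (mem_clauses_rows.2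
      ⟨_, mem_templatesOf.2 (Or.inl ⟨i, rfl⟩), v, rfl⟩))
  · intro h cl hcl
    obtain ⟨tpl, htpl, v, rfl⟩ := mem_clauses_rows.1 hcl
    rcases mem_templatesOf.1 htpl with ⟨i, rfl⟩ | ⟨b, hb, rfl⟩
    · exact (hdemand v i).2 ((h v).1 i)
    · exact (havoid v b).2 ((h v).2 b hb)

theorem exists_eq_iff_of_card_le {α β : Type*} [Fintype β] {s : Finset (α × β)}
    (hs : s.card ≤ Fintype.card β) (h : ∀ b, ∃ a, (a, b) ∈ s) :
    ∃ c : β → α, ∀ a b, (a, b) ∈ s ↔ a = c b := by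
  classical
  choose c hc using h
  have hinj : Function.Injective fun b => (c b, b) := fun _ _ h => (Prod.ext_iff.1 h).2
  have hgraph : Finset.univ.image (fun b => (c b, b)) = s :=
    Finset.eq_of_subset_of_card_le (Finset.image_subset_iff.2 fun b _ => hc b)
      (by rwa [Finset.card_image_of_injective _ hinj])
  refine ⟨c, fun a b => ?_⟩
  simp [← hgraph, eq_comm]

theorem forall_clauses_iff_forall_allowed {x : Fin ((n + 1) * k) → Bool}
    {c : Fin k → Fin (n + 1)} (hx : ∀ p i, x (finProdFinEquiv (p, i)) = true ↔ p = c i) :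
    (∀ cl ∈ clauses (templatesOf s r k) (rows G), ∃ a : Fin ((n + 1) * k),
      (a : ℕ) ∈ cl ∧ x a = true) ↔
    ∀ v, allowed s r (List.ofFn fun i => kind G v (c i)) = true := by
  simp only [forall_clauses_iff, hx, exists_eq, implies_true, true_and]
  refine forall_congr' fun v => ⟨fun h => ?_, fun h b hb => ?_⟩
  · by_contra hall
    obtain ⟨p, i, rfl, hne⟩ := h (fun i => kind G v (c i)) (by simpa using hall)
    exact hne rfl
  · by_contra! hcon
    have hbv : b = fun i => kind G v (c i) := funext fun i => (hcon (c i) i rfl).symm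
    rw [hbv, h] at hb
    exact absurd hb (by decide)

theorem exists_weight_clauses_iff :
    (∃ x : Fin ((n + 1) * k) → Bool, (Finset.univ.filter fun i => x i = true).card = k ∧
      ∀ cl ∈ clauses (templatesOf s r k) (rows G), ∃ a : Fin ((n + 1) * k),
        (a : ℕ) ∈ cl ∧ x a = true) ↔
    ∃ c : Fin k → Fin (n + 1), ∀ v, allowed s r (List.ofFn fun i => kind G v (c i)) = true := by
  have hcard (x : Fin ((n + 1) * k) → Bool) :
      (Finset.univ.filter fun q => x (finProdFinEquiv q) = true).card =
        (Finset.univ.filter fun i => x i = true).card :=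
    Finset.card_equiv finProdFinEquiv (by simp)
  constructor
  · rintro ⟨x, hk, h⟩
    rcases Nat.eq_zero_or_pos n with rfl | hn
    · exact ⟨fun _ => 0, fun v => v.elim0⟩
    have hchoice := ((forall_clauses_iff x).1 h ⟨0, hn⟩).1
    obtain ⟨c, hc⟩ := exists_eq_iff_of_card_le
      (s := Finset.univ.filter fun q => x (finProdFinEquiv q) = true)
      (by rw [hcard, hk, Fintype.card_fin]) (by simpa using hchoice)
    exact ⟨c, (forall_clauses_iff_forall_allowed (by simpa using hc)).1 h⟩
  · rintro ⟨c, hc⟩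
    let x (a : Fin ((n + 1) * k)) : Bool :=
      decide ((finProdFinEquiv.symm a).1 = c (finProdFinEquiv.symm a).2)
    have hx : ∀ p i, x (finProdFinEquiv (p, i)) = true ↔ p = c i :=
      fun p i => by simp only [x, Equiv.symm_apply_apply, decide_eq_true_eq]
    refine ⟨x, ?_, (forall_clauses_iff_forall_allowed hx).2 hc⟩
    rw [← hcard]
    refine (Finset.card_bij (s := Finset.univ) (fun i _ => (c i, i)) (by simp [hx])
      (fun i _ j _ h => (Prod.ext_iff.1 h).2) ?_).symm.trans (Finset.card_fin k)
    rintro ⟨p, i⟩ hp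
    exact ⟨i, Finset.mem_univ i, by simp_all⟩

end clauses

/-! ### Listings of a set of vertices -/

theorem count_ofFn {α : Type*} [DecidableEq α] {k : ℕ} (f : Fin k → α) (a : α) :
    (List.ofFn f).count a = (Finset.univ.filter fun i => f i = a).card := by
  have h := Fin.card_filter_univ_eq_vector_get_eq_count a (List.Vector.ofFn f)
  rw [List.Vector.toList_ofFn] at h
  rw [← h]
  congr 1
  ext i
  simp [eq_comm]

theorem getD_table {χ : ℕ → Bool} {k j : ℕ} (h : j ≤ k) : (table χ k).getD j false = χ j := by
  rw [table, List.getD_eq_getElem _ _ (by simpa using Nat.lt_succ_of_le h)]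
  simp

section listing

variable {k n : ℕ} {G : SimpleGraph (Fin n)} {c : Fin k → Fin (n + 1)} {D : Finset (Fin n)}

theorem kind_eq_zero {v : Fin n} {p : Fin (n + 1)} : kind G v p = 0 ↔ p = v.castSucc := by
  unfold kind
  split_ifs with h₁ h₂ <;> simp [h₁]

theorem kind_eq_one {v : Fin n} {p : Fin (n + 1)} :
    kind G v p = 1 ↔ ∃ u, p = u.castSucc ∧ G.Adj v u := by
  unfold kind
  split_ifs with h₁ h₂
  · subst h₁
    simp
  · simpa using h₂
  · simpa using h₂

/-- The sequence `c` of choices lists the elements of `D` without repetition; the remaining places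
are filled with the choice `n` of no vertex. -/
structure IsListing (c : Fin k → Fin (n + 1)) (D : Finset (Fin n)) : Prop where
  injective : ∀ i j, c i = c j → c i ≠ Fin.last n → i = j
  mem_iff : ∀ u, u ∈ D ↔ ∃ i, c i = u.castSucc

theorem exists_isListing (hk : D.card ≤ k) : ∃ c : Fin k → Fin (n + 1), IsListing c D := by
  let c (i : Fin k) : Fin (n + 1) := (D.toList[(i : ℕ)]?).elim (Fin.last n) Fin.castSucc
  have hc (i : Fin k) (u : Fin n) : c i = u.castSucc ↔ D.toList[(i : ℕ)]? = some u := by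
    cases h : D.toList[(i : ℕ)]? <;> simp [c, h, (Fin.castSucc_lt_last u).ne']
  refine ⟨c, fun i j hij hi => ?_, fun u => ?_⟩
  · obtain ⟨u, hu⟩ := Fin.exists_castSucc_eq.2 hi
    have hiu := (hc i u).1 hu.symm
    have hju := (hc j u).1 (hij.symm.trans hu.symm)
    exact Fin.ext ((List.getElem?_inj (List.getElem?_eq_some_iff.1 hiu).1 D.nodup_toList).1
      (hiu.trans hju.symm))
  · simp only [hc, ← Finset.mem_toList, List.mem_iff_getElem?]
    refine ⟨fun ⟨i, hi⟩ => ?_, fun ⟨i, hi⟩ => ⟨i, hi⟩⟩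
    have hlt := (List.getElem?_eq_some_iff.1 hi).1
    rw [Finset.length_toList] at hlt
    exact ⟨⟨i, hlt.trans_le hk⟩, hi⟩

theorem IsListing.card_filter (h : IsListing c D) (P : Fin n → Prop) [DecidablePred P]
    [DecidablePred fun i => ∃ u, c i = u.castSucc ∧ P u] :
    (Finset.univ.filter fun i => ∃ u, c i = u.castSucc ∧ P u).card = (D.filter P).card := by
  rw [← Finset.card_map Fin.castSuccEmb (s := D.filter P),
    ← Finset.card_image_of_injOn (f := c)]
  · congr 1
    ext p
    simp only [Finset.mem_image, Finset.mem_filter, Finset.mem_univ, true_and, Finset.mem_map,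
      Fin.coe_castSuccEmb, h.mem_iff]
    constructor
    · rintro ⟨i, ⟨u, hu, hP⟩, rfl⟩
      exact ⟨u, ⟨⟨i, hu⟩, hP⟩, hu.symm⟩
    · rintro ⟨u, ⟨⟨i, hu⟩, hP⟩, rfl⟩
      exact ⟨i, ⟨u, hu, hP⟩, hu⟩
  · intro i hi j _ hij
    obtain ⟨u, hu, -⟩ := (Finset.mem_filter.1 hi).2
    exact h.injective i j hij (hu ▸ (Fin.castSucc_lt_last u).ne)

theorem IsListing.card_le (h : IsListing c D) : D.card ≤ k := by
  classical
  calc D.card = (Finset.univ.filter fun i => ∃ u : Fin n, c i = u.castSucc ∧ True).card := by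
        rw [h.card_filter fun _ => True, Finset.filter_true]
    _ ≤ k := (Finset.card_filter_le _ _).trans_eq (Finset.card_fin k)

theorem IsListing.count_zero (h : IsListing c D) (v : Fin n) :
    (List.ofFn fun i => kind G v (c i)).count 0 = if v ∈ D then 1 else 0 := by
  have hv := h.card_filter fun u => u = v
  simp only [exists_eq_right, Finset.filter_eq'] at hv
  simp only [count_ofFn, kind_eq_zero, hv]
  split_ifs <;> simp

theorem IsListing.count_one (h : IsListing c D) (v : Fin n) :
    (List.ofFn fun i => kind G v (c i)).count 1 = (G.neighborSet v ∩ D).ncard := by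
  classical
  have hcoe : G.neighborSet v ∩ D = (D.filter fun u => G.Adj v u : Finset (Fin n)) := by
    ext u
    simp [and_comm]
  simp only [count_ofFn, kind_eq_one]
  rw [hcoe, Set.ncard_coe_finset, h.card_filter fun u => G.Adj v u]

theorem exists_isListing_of_allowed {s r : List Bool}
    (h : ∀ v, allowed s r (List.ofFn fun i => kind G v (c i)) = true) : ∃ D, IsListing c D := by
  refine ⟨Finset.univ.filter fun u => ∃ i, c i = u.castSucc, fun i j hij hi => ?_, by simp⟩
  obtain ⟨v, hv⟩ := Fin.exists_castSucc_eq.2 hi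
  have hcount : (List.ofFn fun i => kind G v (c i)).count 0 ≤ 1 := by
    by_contra hgt
    have hv' := h v
    rw [allowed, if_neg (by omega), if_neg (by omega)] at hv'
    exact absurd hv' (by decide)
  rw [count_ofFn, Finset.card_le_one] at hcount
  exact hcount i (by simp [kind_eq_zero, hv]) j (by simp [kind_eq_zero, hv, hij])

variable {σ ρ : Set ℕ} {χσ χρ : ℕ → Bool} (hσ : ∀ j, χσ j = true ↔ j ∈ σ)
  (hρ : ∀ j, χρ j = true ↔ j ∈ ρ)

include hσ hρ

theorem IsListing.forall_allowed_table_iff (h : IsListing c D) :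
    (∀ v, allowed (table χσ k) (table χρ k) (List.ofFn fun i => kind G v (c i)) = true) ↔
      IsSigmaRhoDominating σ ρ G D := by
  rw [IsSigmaRhoDominating, ← forall_and]
  refine forall_congr' fun v => ?_
  have hle : (List.ofFn fun i => kind G v (c i)).count 1 ≤ k :=
    List.count_le_length.trans (by simp)
  rw [allowed, getD_table hle, getD_table hle, h.count_one, h.count_zero]
  by_cases hv : v ∈ D <;> simp [hv, hσ, hρ]

theorem exists_allowed_table_iff :
    (∃ c : Fin k → Fin (n + 1), ∀ v,
      allowed (table χσ k) (table χρ k) (List.ofFn fun i => kind G v (c i)) = true) ↔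
    ∃ D : Finset (Fin n), IsSigmaRhoDominating σ ρ G D ∧ D.card ≤ k := by
  constructor
  · rintro ⟨c, hc⟩
    obtain ⟨D, hD⟩ := exists_isListing_of_allowed hc
    exact ⟨D, (hD.forall_allowed_table_iff hσ hρ).1 hc, hD.card_le⟩
  · rintro ⟨D, hdom, hk⟩
    obtain ⟨c, hc⟩ := exists_isListing hk
    exact ⟨c, (hc.forall_allowed_table_iff hσ hρ).2 hdom⟩

end listing

/-! ### The reduction -/

/-- The circuit of an instance. -/
noncomputable def circuit (χσ χρ : ℕ → Bool) (x : GraphInst) : Circuit :=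
  cnfCircuit ((x.n + 1) * x.k) (clauses (templates χσ χρ x.k) (rows x.G)) lt_of_mem_clauses

/-- The reduction to the weighted satisfiability of circuits of weft and depth two. -/
noncomputable def reduction (χσ χρ : ℕ → Bool) (x : GraphInst) : (weightedCircuitSat 2 2).Inst :=
  (⟨circuit χσ χρ x, cnfCircuit_weft_le _, cnfCircuit_depth_le _⟩, x.k)

theorem yes_iff_yes_reduction {σ ρ : Set ℕ} {χσ χρ : ℕ → Bool} (hσ : ∀ j, χσ j = true ↔ j ∈ σ)
    (hρ : ∀ j, χρ j = true ↔ j ∈ ρ) (x : GraphInst) :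
    (sigmaRhoDominatingSet σ ρ).Yes x ↔ (weightedCircuitSat 2 2).Yes (reduction χσ χρ x) := by
  refine (exists_allowed_table_iff hσ hρ).symm.trans (exists_weight_clauses_iff.symm.trans ?_)
  exact exists_congr fun y => and_congr_right fun _ => (cnfCircuit_eval lt_of_mem_clauses y).symm

/-! ### Building blocks with a time bound -/

theorem reverse_encodeNat (n : ℕ) : (encodeNat n).reverse = false :: List.replicate n true := by
  have h := replicate_append_encodeNat n []
  rw [List.append_nil] at h
  simp [← h]

namespace StackProg

variable {K : Type}

/-- Move one bit from the nonempty stack `a` to stack `b`. -/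
def moveBit (a b : K) : StackProg K :=
  .ite a isOne (.pop a ;; .push b true) (.pop a ;; .push b false)

/-- Move all of stack `a` to stack `b`, reversing it. -/
def pour (a b : K) : StackProg K := .loop a Option.isSome (moveBit a b)

/-- Empty the stack `a`. -/
def clear (a : K) : StackProg K := .loop a Option.isSome (.pop a)

/-- Push the bits of a word onto stack `a`, the first one first. -/
def pushAll (a : K) : List Bool → StackProg K
  | [] => skip a
  | b :: w => .push a b ;; pushAll a w

/-- Push as many `1`s onto stack `b` as there are on stack `a`, with the help of the empty stack
`d`. -/
def addNum (a d b : K) : StackProg K :=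
  .loop a Option.isSome (.pop a ;; .push d true ;; .push b true) ;; pour d a

/-- Push the reversed code of the size of stack `a` onto stack `b`, with the help of the empty stack
`d`. -/
def emitNum (a d b : K) : StackProg K := addNum a d b ;; .push b false

variable [DecidableEq K]

theorem runsIn_loop_list {α : Type} {a : K} {c : Option Bool → Bool} {p : StackProg K} {T : ℕ}
    (total : List α) (I : List α → List α → K → List Bool)
    (h : ∀ d x l, d.reverse ++ x :: l = total →
      c (I d (x :: l) a).head? = true ∧ RunsIn p (I d (x :: l)) T (I (x :: d) l))
    (h₀ : c (I total.reverse [] a).head? = false) :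
    RunsIn (.loop a c p) (I [] total) (total.length * (T + 1) + 1) (I total.reverse []) := by
  suffices ∀ l d, d.reverse ++ l = total →
      RunsIn (.loop a c p) (I d l) (l.length * (T + 1) + 1) (I total.reverse []) from
    this total [] rfl
  intro l
  induction l with
  | nil =>
    intro d hd
    obtain rfl : d = total.reverse := by simp [← hd]
    simpa using RunsIn.loop_false h₀
  | cons x l ih =>
    intro d hd
    obtain ⟨hc, hx⟩ := h d x l hd
    refine (RunsIn.loop_true hc hx (ih (x :: d) (by simpa using hd))).mono ?_
    rw [List.length_cons]
    linarith

theorem runsIn_loop_nat {a : K} {c : Option Bool → Bool} {p : StackProg K} {T : ℕ} (n : ℕ)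
    (I : ℕ → ℕ → K → List Bool)
    (h : ∀ d r, d + (r + 1) = n →
      c (I d (r + 1) a).head? = true ∧ RunsIn p (I d (r + 1)) T (I (d + 1) r))
    (h₀ : c (I n 0 a).head? = false) :
    RunsIn (.loop a c p) (I 0 n) (n * (T + 1) + 1) (I n 0) := by
  have hlist := runsIn_loop_list (a := a) (c := c) (p := p) (T := T) (List.replicate n ())
    (fun d l => I d.length l.length)
    (fun d x l hl => h _ _ (by simpa using congrArg List.length hl))
    (by simpa using h₀)
  simpa using hlist

theorem runsIn_moveBit {a b : K} (hab : a ≠ b) {S : K → List Bool} {x : Bool} {l : List Bool}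
    (h : S a = x :: l) :
    RunsIn (moveBit a b) S 3 (Function.update (Function.update S a l) b (x :: S b)) := by
  have hmove (y : Bool) : RunsIn (.pop a ;; .push b y) S 2
      (Function.update (Function.update S a l) b (y :: S b)) :=
    ((runsIn_pop a S).seq (runsIn_push b y _)).congr le_rfl (by simp [h, hab.symm])
  cases x
  · exact .ite_false (by simp [h, isOne]) (hmove false)
  · exact .ite_true (by simp [h, isOne]) (hmove true)

theorem runsIn_pour {a b : K} (hab : a ≠ b) (S : K → List Bool) :
    RunsIn (pour a b) S (4 * (S a).length + 1)
      (Function.update (Function.update S a []) b ((S a).reverse ++ S b)) := by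
  let I (d l : List Bool) := Function.update (Function.update S a l) b (d ++ S b)
  have hI (d l : List Bool) : I d l a = l := by simp [I, hab]
  have hbody (d x l) : RunsIn (moveBit a b) (I d (x :: l)) 3 (I (x :: d) l) :=
    (runsIn_moveBit hab (hI d (x :: l))).congr le_rfl (by
      simp only [I, Function.update_self, Function.update_comm hab.symm, Function.update_idem,
        List.cons_append])
  have h := runsIn_loop_list (a := a) (c := Option.isSome) (S a) I
    (fun d x l _ => ⟨by simp [hI], hbody d x l⟩) (by simp [hI])
  have hstart : I [] (S a) = S := by simp [I]
  rw [hstart] at h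
  exact h.mono (by omega)

theorem runsIn_clear (a : K) (S : K → List Bool) :
    RunsIn (clear a) S (2 * (S a).length + 1) (Function.update S a []) := by
  have h := runsIn_loop_list (a := a) (c := Option.isSome) (p := .pop a) (T := 1) (S a)
    (fun _ l => Function.update S a l)
    (fun d x l _ => ⟨by simp, (runsIn_pop _ _).congr le_rfl (by simp)⟩) (by simp)
  rw [Function.update_eq_self] at h
  exact h.mono (by omega)

theorem runsIn_pushAll (a : K) (w : List Bool) (S : K → List Bool) :
    RunsIn (pushAll a w) S (w.length + 2) (Function.update S a (w.reverse ++ S a)) := by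
  induction w generalizing S with
  | nil => exact (runsIn_skip a S).congr (by simp) (by simp)
  | cons b w ih =>
    exact ((runsIn_push a b S).seq (ih _)).congr (by rw [List.length_cons]; omega) (by simp)

theorem runsIn_addNum {a d b : K} (had : a ≠ d) (hab : a ≠ b) (hdb : d ≠ b) {n : ℕ}
    {S : K → List Bool} (ha : S a = List.replicate n true) (hd : S d = []) :
    RunsIn (addNum a d b) S (8 * n + 2) (Function.update S b (List.replicate n true ++ S b)) := by
  let I (i r : ℕ) : K → List Bool :=
    Function.update (Function.update (Function.update S a (List.replicate r true)) d
      (List.replicate i true)) b (List.replicate i true ++ S b)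
  have hbody (i r : ℕ) : RunsIn (.pop a ;; .push d true ;; .push b true) (I i (r + 1)) 3
      (I (i + 1) r) :=
    ((runsIn_pop a _).seq ((runsIn_push d true _).seq (runsIn_push b true _))).congr le_rfl (by
      funext j
      by_cases hb : j = b <;> by_cases hd : j = d <;> by_cases ha : j = a <;>
        simp_all [I, List.replicate_succ])
  have h := runsIn_loop_nat (a := a) (c := Option.isSome) n I
    (fun i r _ => ⟨by simp [I, had, hab, List.replicate_succ], hbody i r⟩) (by simp [I, had, hab])
  have hstart : I 0 n = S := by simp [I, ← ha, ← hd]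
  rw [hstart] at h
  refine (h.seq (runsIn_pour had.symm _)).congr ?_ ?_
  · simp only [I, ne_eq, hdb, not_false_eq_true, Function.update_of_ne, Function.update_self,
      List.length_replicate]
    omega
  · funext j
    by_cases hb : j = b <;> by_cases hd : j = d <;> by_cases ha : j = a <;> simp_all [I]

theorem runsIn_emitNum {a d b : K} (had : a ≠ d) (hab : a ≠ b) (hdb : d ≠ b) {n : ℕ}
    {S : K → List Bool} (ha : S a = List.replicate n true) (hd : S d = []) :
    RunsIn (emitNum a d b) S (8 * n + 3) (Function.update S b ((encodeNat n).reverse ++ S b)) :=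
  ((runsIn_addNum had hab hdb ha hd).seq (runsIn_push _ _ _)).congr le_rfl
    (by simp [reverse_encodeNat])

end StackProg

/-! ### The stacks of the machine -/

/-- The stacks of the machine that computes the reduction: `code` are the stacks of the program that
computes the templates, `input` and `output` hold the input and the output, and `acc` the reversed
output while it is produced. Unary counters hold the numbers of vertices, slots, variables and
clauses, the current variable `var`, and the numbers of columns to the left and to the right of the
diagonal in the current row of the adjacency matrix. The rows of kinds are kept on `kinds` and
`kindsRev`, the current template on `masks` and `masksRev`. -/
inductive Stack
  | code (i : Fin 4)
  | input | output | acc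
  | numVerts | numSlots | numVars | numClauses | var
  | left | leftTmp | right | rightTmp
  | kinds | kindsRev | masks | masksRev | tmp
  deriving DecidableEq, Fintype

/-- The contents of the stacks. -/
structure Memory where
  code : Fin 4 → List Bool := quad [] [] [] []
  (input output acc : List Bool := [])
  (numVerts numSlots numVars numClauses var : List Bool := [])
  (left leftTmp right rightTmp : List Bool := [])
  (kinds kindsRev masks masksRev tmp : List Bool := [])

namespace Memory

/-- The contents of one stack. -/
@[simp]
def get (m : Memory) : Stack → List Bool
  | .code i => m.code i
  | .input => m.input
  | .output => m.output
  | .acc => m.acc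
  | .numVerts => m.numVerts
  | .numSlots => m.numSlots
  | .numVars => m.numVars
  | .numClauses => m.numClauses
  | .var => m.var
  | .left => m.left
  | .leftTmp => m.leftTmp
  | .right => m.right
  | .rightTmp => m.rightTmp
  | .kinds => m.kinds
  | .kindsRev => m.kindsRev
  | .masks => m.masks
  | .masksRev => m.masksRev
  | .tmp => m.tmp

/-- Replace the contents of one stack. -/
@[simp]
def set (m : Memory) (w : List Bool) : Stack → Memory
  | .code i => { m with code := Function.update m.code i w }
  | .input => { m with input := w }
  | .output => { m with output := w }
  | .acc => { m with acc := w }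
  | .numVerts => { m with numVerts := w }
  | .numSlots => { m with numSlots := w }
  | .numVars => { m with numVars := w }
  | .numClauses => { m with numClauses := w }
  | .var => { m with var := w }
  | .left => { m with left := w }
  | .leftTmp => { m with leftTmp := w }
  | .right => { m with right := w }
  | .rightTmp => { m with rightTmp := w }
  | .kinds => { m with kinds := w }
  | .kindsRev => { m with kindsRev := w }
  | .masks => { m with masks := w }
  | .masksRev => { m with masksRev := w }
  | .tmp => { m with tmp := w }

@[simp]
theorem update_get (m : Memory) (s : Stack) (w : List Bool) :
    Function.update m.get s w = (m.set w s).get := by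
  refine Function.update_eq_iff.2 ⟨?_, fun j hj => ?_⟩
  · cases s <;> simp
  · cases s <;> cases j <;> simp_all

theorem get_default : ({} : Memory).get = fun _ => [] := by
  funext s
  cases s with
  | code i => fin_cases i <;> rfl
  | _ => rfl

theorem extend_code (m : Memory) (c : Fin 4 → List Bool) :
    Function.extend Stack.code c m.get = { m with code := c }.get := by
  funext s
  by_cases hs : ∃ i, Stack.code i = s
  · obtain ⟨i, rfl⟩ := hs
    exact Function.Injective.extend_apply (fun _ _ h => Stack.code.inj h) _ _ i
  · rw [Function.extend_apply' _ _ _ hs]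
    cases s with
    | code i => exact absurd ⟨i, rfl⟩ hs
    | _ => rfl

theorem runsIn_moveBit {m : Memory} {a b : Stack} (hab : a ≠ b) {x : Bool} {l : List Bool}
    (h : m.get a = x :: l) :
    StackProg.RunsIn (StackProg.moveBit a b) m.get 3 ((m.set l a).set (x :: m.get b) b).get :=
  (StackProg.runsIn_moveBit hab h).congr le_rfl (by simp only [update_get])

end Memory

/-! ### Writing the clauses -/

/-- The code of a list of entries, without the end mark. -/
def entries {α : Type} (e : α → List Bool) (l : List α) : List Bool :=
  l.flatMap fun a => true :: e a

theorem encodeList_eq_entries {α : Type} (e : α → List Bool) (l : List α) :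
    encodeList e l = entries e l ++ [false] := encodeList_eq_flatMap e l

theorem entries_append {α : Type} (e : α → List Bool) (l l' : List α) :
    entries e (l ++ l') = entries e l ++ entries e l' := List.flatMap_append

theorem entries_singleton {α : Type} (e : α → List Bool) (a : α) :
    entries e [a] = true :: e a := List.flatMap_singleton _ a

theorem head?_encodeList_append_isSome {α : Type} (e : α → List Bool) (l : List α)
    (w : List Bool) : (encodeList e l ++ w).head?.isSome = true := by
  cases l <;> simp [encodeList]

theorem length_encodeList_mask (l : List Mask) :
    (encodeList encodeMask l).length = 4 * l.length + 1 := by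
  induction l with
  | nil => rfl
  | cons x l ih =>
    simp only [encodeList, encodeMask, List.length_cons, List.length_append, List.length_nil, ih]
    omega

theorem slotArgs_append_singleton (τ : Fin 3) (c : ℕ) (l : List Mask) (x : Mask) :
    slotArgs τ c (l ++ [x]) = slotArgs τ c l ++ if x τ then [c + l.length] else [] := by
  induction l generalizing c with
  | nil => simp [slotArgs]
  | cons y l ih =>
    simp only [List.cons_append, slotArgs, ih, List.length_cons, Nat.add_right_comm c 1,
      ← Nat.add_assoc]
    split_ifs <;> simp

theorem clauseArgs_append_singleton (tpl : List Mask) (c : ℕ) (l : List (Fin 3)) (τ : Fin 3) :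
    clauseArgs tpl c (l ++ [τ]) =
      clauseArgs tpl c l ++ slotArgs τ (c + l.length * tpl.length) tpl := by
  induction l generalizing c with
  | nil => simp [clauseArgs]
  | cons y l ih =>
    simp only [List.cons_append, clauseArgs, ih, List.length_cons, List.append_assoc]
    congr 3
    ring

/-- The binary code of a kind. -/
def encodeKind : Fin 3 → List Bool
  | 0 => [true]
  | 1 => [false, true]
  | 2 => [false, false]

theorem length_encodeList_kind_le (l : List (Fin 3)) :
    (encodeList encodeKind l).length ≤ 3 * l.length + 1 := by
  induction l with
  | nil => simp [encodeList]
  | cons x l ih =>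
    have hx : (encodeKind x).length ≤ 2 := by fin_cases x <;> simp [encodeKind]
    simp only [encodeList, List.length_cons, List.length_append]
    omega

theorem length_flatMap_encodeList_kind_le {r : ℕ} (rows : List (List (Fin 3)))
    (h : ∀ row ∈ rows, row.length = r) :
    (rows.flatMap (encodeList encodeKind)).length ≤ rows.length * (3 * r + 1) := by
  rw [List.length_flatMap]
  refine (List.sum_le_card_nsmul _ (3 * r + 1) fun j hj => ?_).trans_eq (by simp)
  obtain ⟨row, hrow, rfl⟩ := List.mem_map.1 hj
  exact h row hrow ▸ length_encodeList_kind_le row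

/-- The code of a clause as an element of the list of gates. -/
def encodeClause (cl : List ℕ) : List Bool := true :: (Gate.or cl).encode

namespace StackProg

/-- Move a bit of the current mask; if `b` holds and the bit is set, write the current variable. -/
def bitProg : Bool → StackProg Stack
  | true => .ite .masks isOne (.push .acc true ;; emitNum .var .tmp .acc) (skip .tmp) ;;
      moveBit .masks .masksRev
  | false => moveBit .masks .masksRev

/-- Read a mask, write the current variable if the mask selects the kind `τ`, and go on to the next
variable. -/
def slotProg (τ : Fin 3) : StackProg Stack :=
  moveBit .masks .masksRev ;; bitProg (τ = 0) ;; bitProg (τ = 1) ;; bitProg (τ = 2) ;;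
    .push .var true

/-- Write the variables that the current template selects in a column of kind `τ`. -/
def slotsProg (τ : Fin 3) : StackProg Stack :=
  pour .masksRev .masks ;; .loop .masks isOne (slotProg τ) ;; moveBit .masks .masksRev

/-- Read a kind and write the variables of a column of this kind. -/
def kindProg : StackProg Stack :=
  moveBit .kinds .kindsRev ;;
  .ite .kinds isOne (moveBit .kinds .kindsRev ;; slotsProg 0)
    (moveBit .kinds .kindsRev ;;
      .ite .kinds isOne (moveBit .kinds .kindsRev ;; slotsProg 1)
        (moveBit .kinds .kindsRev ;; slotsProg 2))

/-- Read a row of kinds and write the clause of the current template. -/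
def rowProg : StackProg Stack :=
  pushAll .acc [true, true, true] ;; .loop .kinds isOne kindProg ;; moveBit .kinds .kindsRev ;;
    .push .acc false ;; .push .numClauses true ;; clear .var

/-- Read a template. -/
def readTemplate : StackProg Stack :=
  .loop (.code 1) isOne (moveBit (.code 1) .masksRev ;; moveBit (.code 1) .masksRev ;;
    moveBit (.code 1) .masksRev ;; moveBit (.code 1) .masksRev) ;; moveBit (.code 1) .masksRev

/-- Read a template and write the clauses of all rows. -/
def templateProg : StackProg Stack :=
  readTemplate ;; pour .kindsRev .kinds ;; .loop .kinds Option.isSome rowProg ;; clear .masksRev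

/-- Write the clauses of all templates. -/
def clausesProg : StackProg Stack := .loop (.code 1) Option.isSome templateProg

/-- A bound for the time that a row of length `r` takes with a template of length `k`. -/
def rowTime (k r : ℕ) : ℕ := r * (k * (24 * (r * k) + 45) + 21) + 2 * (r * k) + 14

/-- A bound for the time that a template of length `k` takes with `n` rows of length `r`. -/
def templateTime (k r n : ℕ) : ℕ := n * (rowTime k r + 12 * r + 5) + 29 * k + 12

theorem runsIn_bitProg (b x : Bool) (l : List Bool) (c : ℕ) {m : Memory} (htmp : m.tmp = [])
    (hvar : m.var = List.replicate c true) (hmasks : m.masks = x :: l) :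
    RunsIn (bitProg b) m.get (8 * c + 8) { m with
      masks := l
      masksRev := x :: m.masksRev
      acc := (if b && x then (true :: encodeNat c).reverse else []) ++ m.acc }.get := by
  have hmove {m : Memory} (h : m.masks = x :: l) :=
    Memory.runsIn_moveBit (a := .masks) (b := .masksRev) (by simp) h
  cases b
  · exact (hmove hmasks).congr (by omega) (by simp)
  cases x
  · exact ((RunsIn.ite_false (by simp [hmasks, isOne]) (runsIn_skip _ _)).seq
      (hmove hmasks)).congr (by omega) (by simp)
  · have hemit := (runsIn_push .acc true m.get).seq (runsIn_emitNum (a := .var) (d := .tmp)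
      (b := .acc) (n := c) (by simp) (by simp) (by simp) (by exact hvar) (by exact htmp))
    simp only [Memory.update_get, Memory.set] at hemit
    exact ((hemit.ite_true (by simp [hmasks, isOne])).seq (hmove hmasks)).congr (by omega)
      (by simp)

theorem runsIn_slotProg (τ : Fin 3) (x : Mask) (l : List Bool) (c : ℕ) {m : Memory}
    (htmp : m.tmp = []) (hvar : m.var = List.replicate c true)
    (hmasks : m.masks = true :: (encodeMask x ++ l)) :
    RunsIn (slotProg τ) m.get (24 * c + 28) { m with
      masks := l
      masksRev := (true :: encodeMask x).reverse ++ m.masksRev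
      var := List.replicate (c + 1) true
      acc := (if x τ then (true :: encodeNat c).reverse else []) ++ m.acc }.get := by
  refine RunsIn.congr ((Memory.runsIn_moveBit (a := .masks) (by simp) hmasks).seq
    ((runsIn_bitProg _ (x 0) (x 1 :: x 2 :: l) c (by exact htmp) (by exact hvar) rfl).seq
    ((runsIn_bitProg _ (x 1) (x 2 :: l) c (by exact htmp) (by exact hvar) rfl).seq
    ((runsIn_bitProg _ (x 2) l c (by exact htmp) (by exact hvar) rfl).seq
    (runsIn_push _ _ _))))) (by omega) ?_
  simp only [Memory.update_get, Memory.set, Memory.get, encodeMask, hvar, List.replicate_succ]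
  congr 1
  fin_cases τ <;> simp

theorem runsIn_slotsProg (τ : Fin 3) (tpl : List Mask) (c N : ℕ) {m : Memory}
    (htmp : m.tmp = []) (hmasks : m.masks = [])
    (hmasksRev : m.masksRev = (encodeList encodeMask tpl).reverse)
    (hvar : m.var = List.replicate c true) (hN : c + tpl.length ≤ N) :
    RunsIn (slotsProg τ) m.get (tpl.length * (24 * N + 45) + 9) { m with
      var := List.replicate (c + tpl.length) true
      acc := (entries encodeNat (slotArgs τ c tpl)).reverse ++ m.acc }.get := by
  let I (d l : List Mask) : Memory := { m with
    masks := encodeList encodeMask l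
    masksRev := (entries encodeMask d.reverse).reverse
    var := List.replicate (c + d.length) true
    acc := (entries encodeNat (slotArgs τ c d.reverse)).reverse ++ m.acc }
  have hpour : RunsIn (pour .masksRev .masks) m.get (16 * tpl.length + 5) (I [] tpl).get := by
    refine (runsIn_pour (by simp) m.get).congr ?_
      (by simp [I, hmasksRev, hmasks, ← hvar, entries, slotArgs])
    simp only [Memory.get, hmasksRev, List.length_reverse, length_encodeList_mask]
    omega
  have hbody (d x l) (hl : d.reverse ++ x :: l = tpl) :
      RunsIn (slotProg τ) (I d (x :: l)).get (24 * N + 28) (I (x :: d) l).get := by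
    have hlen := congrArg List.length hl
    simp only [List.length_append, List.length_reverse, List.length_cons] at hlen
    refine (runsIn_slotProg τ x (encodeList encodeMask l) (c + d.length) (m := I d (x :: l))
      htmp rfl rfl).congr (by omega) ?_
    simp only [I, List.reverse_cons, entries_append, slotArgs_append_singleton, entries_singleton]
    split_ifs <;> simp [entries, Nat.add_assoc]
  have hloop := runsIn_loop_list (a := .masks) (c := isOne) tpl (fun d l => (I d l).get)
    (fun d x l hl => ⟨by simp [I, encodeList, isOne], hbody d x l hl⟩)
    (by simp [I, encodeList, isOne])
  have hend := Memory.runsIn_moveBit (m := I tpl.reverse []) (a := .masks) (b := .masksRev)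
    (by simp) rfl
  refine (hpour.seq (hloop.seq hend)).congr (by linarith) ?_
  simp [I, hmasksRev, hmasks, encodeList_eq_entries]

theorem runsIn_kindProg (τ : Fin 3) (tpl : List Mask) (c N : ℕ) (rest : List Bool)
    {m : Memory} (hkinds : m.kinds = true :: (encodeKind τ ++ rest))
    (htmp : m.tmp = []) (hmasks : m.masks = [])
    (hmasksRev : m.masksRev = (encodeList encodeMask tpl).reverse)
    (hvar : m.var = List.replicate c true) (hN : c + tpl.length ≤ N) :
    RunsIn kindProg m.get (tpl.length * (24 * N + 45) + 20) { m with
      kinds := rest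
      kindsRev := (true :: encodeKind τ).reverse ++ m.kindsRev
      var := List.replicate (c + tpl.length) true
      acc := (entries encodeNat (slotArgs τ c tpl)).reverse ++ m.acc }.get := by
  have hmove (x : Bool) (l : List Bool) {m : Memory} (h : m.kinds = x :: l) :
      RunsIn (moveBit .kinds .kindsRev) m.get 3
        { m with kinds := l, kindsRev := x :: m.kindsRev }.get :=
    Memory.runsIn_moveBit (a := .kinds) (b := .kindsRev) (by simp) h
  have hslots (w w' : List Bool) := runsIn_slotsProg τ tpl c N
    (m := { m with kinds := w, kindsRev := w' }) htmp hmasks hmasksRev hvar hN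
  have hmark := hmove _ _ hkinds
  match τ, hslots, hmark with
  | 0, hslots, hmark =>
    exact (hmark.seq (RunsIn.ite_true (by rfl) ((hmove true rest (by rfl)).seq
      (hslots _ _)))).congr (by omega) (by simp [encodeKind])
  | 1, hslots, hmark =>
    exact (hmark.seq (RunsIn.ite_false (by rfl) ((hmove false (true :: rest) (by rfl)).seq
      (RunsIn.ite_true (by rfl) ((hmove true rest (by rfl)).seq (hslots _ _)))))).congr (by omega)
      (by simp [encodeKind])
  | 2, hslots, hmark =>
    exact (hmark.seq (RunsIn.ite_false (by rfl) ((hmove false (false :: rest) (by rfl)).seq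
      (RunsIn.ite_false (by rfl) ((hmove false rest (by rfl)).seq (hslots _ _)))))).congr (by omega)
      (by simp [encodeKind])

theorem runsIn_rowProg (tpl : List Mask) (row : List (Fin 3)) (rest : List Bool)
    {m : Memory} (hkinds : m.kinds = encodeList encodeKind row ++ rest)
    (htmp : m.tmp = []) (hmasks : m.masks = [])
    (hmasksRev : m.masksRev = (encodeList encodeMask tpl).reverse) (hvar : m.var = []) :
    RunsIn rowProg m.get (rowTime tpl.length row.length) { m with
      kinds := rest
      kindsRev := (encodeList encodeKind row).reverse ++ m.kindsRev
      numClauses := true :: m.numClauses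
      acc := (encodeClause (clauseArgs tpl 0 row)).reverse ++ m.acc }.get := by
  let I (d l : List (Fin 3)) : Memory := { m with
    kinds := encodeList encodeKind l ++ rest
    kindsRev := (entries encodeKind d.reverse).reverse ++ m.kindsRev
    var := List.replicate (d.length * tpl.length) true
    acc := (entries encodeNat (clauseArgs tpl 0 d.reverse)).reverse ++
      true :: true :: true :: m.acc }
  have hstart : RunsIn (pushAll .acc [true, true, true]) m.get 5 (I [] row).get :=
    (runsIn_pushAll _ _ _).congr (by simp) (by simp [I, hkinds, hvar, clauseArgs, entries])
  have hbody (d τ l) (hl : d.reverse ++ τ :: l = row) : RunsIn kindProg (I d (τ :: l)).get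
      (tpl.length * (24 * (row.length * tpl.length) + 45) + 20) (I (τ :: d) l).get := by
    have hlen := congrArg List.length hl
    simp only [List.length_append, List.length_reverse, List.length_cons] at hlen
    refine (runsIn_kindProg τ tpl (d.length * tpl.length) _ (encodeList encodeKind l ++ rest)
      (m := I d (τ :: l)) (by simp [I, encodeList]) htmp hmasks hmasksRev rfl
      ((Nat.succ_mul _ _).symm.trans_le (Nat.mul_le_mul_right _ (by omega)))).congr le_rfl ?_
    simp [I, clauseArgs_append_singleton, entries_append, entries_singleton, Nat.succ_mul]
  have hloop := runsIn_loop_list (a := .kinds) (c := isOne) row (fun d l => (I d l).get)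
    (fun d x l hl => ⟨by simp [I, encodeList, isOne], hbody d x l hl⟩)
    (by simp [I, encodeList, isOne])
  have hend := Memory.runsIn_moveBit (m := I row.reverse []) (a := .kinds) (b := .kindsRev)
    (by simp) (by rfl)
  refine RunsIn.congr (hstart.seq (hloop.seq (hend.seq ((runsIn_push _ _ _).seq
    ((runsIn_push _ _ _).seq (runsIn_clear _ _)))))) ?_ ?_
  · simp only [I, Memory.update_get, Memory.set, Memory.get, List.length_replicate,
      List.length_reverse, rowTime]
    linarith
  · simp [I, hvar, encodeClause, Gate.encode, encodeList_eq_entries]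

theorem runsIn_readTemplate (tpl : List Mask) (rest : List Bool) {m : Memory}
    (hcode : m.code = quad [] (encodeList encodeMask tpl ++ rest) [] [])
    (hmasksRev : m.masksRev = []) :
    RunsIn readTemplate m.get (13 * tpl.length + 4) { m with
      code := quad [] rest [] []
      masksRev := (encodeList encodeMask tpl).reverse }.get := by
  let I (d l : List Mask) : Memory := { m with
    code := quad [] (encodeList encodeMask l ++ rest) [] []
    masksRev := (entries encodeMask d.reverse).reverse }
  have hmove {x : Bool} {l : List Bool} {m : Memory} (h : m.code 1 = x :: l) :=
    Memory.runsIn_moveBit (a := .code 1) (b := .masksRev) (by simp) h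
  have hloop := runsIn_loop_list (a := .code 1) (c := isOne) tpl (fun d l => (I d l).get)
    (fun d x l _ => ⟨by simp [I, encodeList, isOne], RunsIn.congr
      ((hmove (x := true) (l := encodeMask x ++ (encodeList encodeMask l ++ rest))
          (by simp [I, encodeList])).seq
        ((hmove (x := x 0) (l := x 1 :: x 2 :: (encodeList encodeMask l ++ rest)) rfl).seq
        ((hmove (x := x 1) (l := x 2 :: (encodeList encodeMask l ++ rest)) rfl).seq
        (hmove (x := x 2) (l := encodeList encodeMask l ++ rest) rfl)))) le_rfl
        (by simp [I, entries_append, entries_singleton, encodeMask])⟩)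
    (by simp [I, encodeList, isOne])
  have hstart : I [] tpl = m := by cases m; simp_all [I, entries]
  rw [hstart] at hloop
  exact (hloop.seq (hmove (x := false) (l := rest) (by simp [I, encodeList]))).congr (by omega)
    (by simp [I, encodeList_eq_entries])

theorem runsIn_templateProg (tpl : List Mask) (rows : List (List (Fin 3))) {r : ℕ}
    (hr : ∀ row ∈ rows, row.length = r) (rest : List Bool) {m : Memory}
    (hcode : m.code = quad [] (encodeList encodeMask tpl ++ rest) [] []) (hkinds : m.kinds = [])
    (hkindsRev : m.kindsRev = (rows.flatMap (encodeList encodeKind)).reverse)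
    (htmp : m.tmp = []) (hmasks : m.masks = []) (hmasksRev : m.masksRev = []) (hvar : m.var = []) :
    RunsIn templateProg m.get (templateTime tpl.length r rows.length) { m with
      code := quad [] rest [] []
      numClauses := List.replicate rows.length true ++ m.numClauses
      acc := ((rows.map (clauseArgs tpl 0)).flatMap encodeClause).reverse ++ m.acc }.get := by
  let I (d l : List (List (Fin 3))) : Memory := { m with
    code := quad [] rest [] []
    masksRev := (encodeList encodeMask tpl).reverse
    kinds := l.flatMap (encodeList encodeKind)
    kindsRev := (d.reverse.flatMap (encodeList encodeKind)).reverse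
    numClauses := List.replicate d.length true ++ m.numClauses
    acc := ((d.reverse.map (clauseArgs tpl 0)).flatMap encodeClause).reverse ++ m.acc }
  have hpour : RunsIn (pour .kindsRev .kinds)
      { m with code := quad [] rest [] [], masksRev := (encodeList encodeMask tpl).reverse }.get
      (4 * (rows.length * (3 * r + 1)) + 1) (I [] rows).get := by
    refine (runsIn_pour (by simp) _).congr ?_ (by simp [I, hkinds, hkindsRev])
    have hlen := length_flatMap_encodeList_kind_le rows hr
    simp only [Memory.get, hkindsRev, List.length_reverse]
    omega
  have hbody (d row l) (hl : d.reverse ++ row :: l = rows) :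
      RunsIn rowProg (I d (row :: l)).get (rowTime tpl.length r) (I (row :: d) l).get := by
    rw [← hr row (by rw [← hl]; simp)]
    refine (runsIn_rowProg tpl row (l.flatMap (encodeList encodeKind)) (m := I d (row :: l))
      (by simp [I]) htmp hmasks rfl hvar).congr le_rfl ?_
    simp [I, List.replicate_succ]
  have hloop := runsIn_loop_list (a := .kinds) (c := Option.isSome) rows (fun d l => (I d l).get)
    (fun d x l hl => ⟨head?_encodeList_append_isSome _ _ _, hbody d x l hl⟩) (by simp [I])
  refine RunsIn.congr ((runsIn_readTemplate tpl rest hcode hmasksRev).seq (hpour.seq (hloop.seq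
    (runsIn_clear _ _)))) ?_ ?_
  · simp only [I, Memory.get, List.length_reverse, length_encodeList_mask, templateTime]
    linarith
  · simp [I, hkinds, hkindsRev, hmasksRev]

theorem runsIn_clausesProg (tpls : List (List Mask)) (rows : List (List (Fin 3))) {k r : ℕ}
    (hk : ∀ tpl ∈ tpls, tpl.length = k) (hr : ∀ row ∈ rows, row.length = r) {m : Memory}
    (hcode : m.code = quad [] (tpls.flatMap (encodeList encodeMask)) [] []) (hkinds : m.kinds = [])
    (hkindsRev : m.kindsRev = (rows.flatMap (encodeList encodeKind)).reverse)
    (htmp : m.tmp = []) (hmasks : m.masks = []) (hmasksRev : m.masksRev = []) (hvar : m.var = [])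
    (hnum : m.numClauses = []) :
    RunsIn clausesProg m.get (tpls.length * (templateTime k r rows.length + 1) + 1) { m with
      code := quad [] [] [] []
      numClauses := List.replicate (clauses tpls rows).length true
      acc := ((clauses tpls rows).flatMap encodeClause).reverse ++ m.acc }.get := by
  let I (d l : List (List Mask)) : Memory := { m with
    code := quad [] (l.flatMap (encodeList encodeMask)) [] []
    numClauses := List.replicate (clauses d.reverse rows).length true
    acc := ((clauses d.reverse rows).flatMap encodeClause).reverse ++ m.acc }
  have hbody (d tpl l) (hl : d.reverse ++ tpl :: l = tpls) : RunsIn templateProg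
      (I d (tpl :: l)).get (templateTime k r rows.length) (I (tpl :: d) l).get := by
    rw [← hk tpl (by rw [← hl]; simp)]
    refine (runsIn_templateProg tpl rows hr (l.flatMap (encodeList encodeMask))
      (m := I d (tpl :: l)) (by simp [I]) hkinds hkindsRev htmp hmasks hmasksRev hvar).congr
      le_rfl ?_
    simp [I, clauses, Nat.add_mul, Nat.add_comm]
  have hloop := runsIn_loop_list (a := .code 1) (c := Option.isSome) tpls (fun d l => (I d l).get)
    (fun d x l hl => ⟨head?_encodeList_append_isSome _ _ _, hbody d x l hl⟩) (by simp [I])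
  have hstart : I [] tpls = m := by cases m; simp_all [I, clauses]
  rw [hstart] at hloop
  exact hloop.congr le_rfl (by simp [I])

end StackProg

/-! ### Reading the input -/

/-- The kind of a vertex other than the one that the row belongs to, given its bit in the row. -/
def bitKind (b : Bool) : Fin 3 := if b then 1 else 2

/-- The bits of a row of the adjacency matrix. -/
noncomputable def adjRow {n : ℕ} (G : SimpleGraph (Fin n)) (v : Fin n) : List Bool :=
  open Classical in (List.finRange n).map fun u => decide (G.Adj v u)

theorem adjBits_eq_flatMap {n : ℕ} (G : SimpleGraph (Fin n)) :
    adjBits G = (List.finRange n).flatMap (adjRow G) := rfl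

theorem kind_last {n : ℕ} (G : SimpleGraph (Fin n)) (v : Fin n) : kind G v (Fin.last n) = 2 := by
  have h (u : Fin n) : Fin.last n ≠ u.castSucc := (Fin.castSucc_lt_last u).ne'
  simp [kind, h]

open Classical in
theorem kind_castSucc {n : ℕ} (G : SimpleGraph (Fin n)) {u v : Fin n} (h : u ≠ v) :
    kind G v u.castSucc = bitKind (decide (G.Adj v u)) := by
  simp [kind, bitKind, h]

theorem ofFn_kind {n : ℕ} (G : SimpleGraph (Fin n)) (v : Fin n) :
    List.ofFn (kind G v) = ((adjRow G v).map bitKind).set v 0 ++ [2] := by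
  rw [List.ofFn_succ', List.concat_eq_append, kind_last]
  congr 1
  refine List.ext_getElem (by simp [adjRow]) fun i hi _ => ?_
  rw [List.length_ofFn] at hi
  rw [List.getElem_ofFn, List.getElem_set]
  split_ifs with hv
  · exact kind_eq_zero.2 (Fin.ext hv.symm)
  · rw [kind_castSucc G fun h => hv (congrArg Fin.val h).symm]
    simp [adjRow]

theorem exists_adjRow_eq_append {n : ℕ} (G : SimpleGraph (Fin n)) (v : Fin n) :
    ∃ w₁ b w₂, adjRow G v = w₁ ++ b :: w₂ ∧ w₁.length = (v : ℕ) ∧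
      v + w₂.length + 1 = n := by
  have hlen : (adjRow G v).length = n := by simp [adjRow]
  have hv : (v : ℕ) < (adjRow G v).length := hlen.symm ▸ v.2
  refine ⟨(adjRow G v).take v, (adjRow G v)[(v : ℕ)], (adjRow G v).drop (v + 1), by simp, ?_, ?_⟩
  · rw [List.length_take]
    omega
  · rw [List.length_drop]
    omega

namespace StackProg

/-- Read the number of vertices and the number of slots; a copy of the latter is handed over to the
program that computes the templates. -/
def parseProg : StackProg Stack :=
  .loop .input isOne (.pop .input ;; .push .numVerts true) ;; .pop .input ;;
  pushAll (.code 0) [false, false] ;;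
  .loop .input isOne (.pop .input ;; .push .numSlots true ;; .push (.code 0) true) ;;
  .pop .input ;; .push (.code 0) true

/-- Turn a bit of the input into a kind. -/
def copyBit : StackProg Stack :=
  .ite .input isOne (pushAll .kindsRev [true, false, true])
    (pushAll .kindsRev [true, false, false]) ;; .pop .input

/-- Turn the bits to the left of the diagonal into kinds. -/
def copyLeft : StackProg Stack := .loop .left Option.isSome (moveBit .left .leftTmp ;; copyBit)

/-- Turn the bits to the right of the diagonal into kinds. -/
def copyRight : StackProg Stack := .loop .right Option.isSome (moveBit .right .rightTmp ;; copyBit)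

/-- Turn a row of the adjacency matrix into a row of kinds. -/
def matrixRowProg : StackProg Stack :=
  .pop .right ;; copyLeft ;; .pop .input ;; pushAll .kindsRev [true, true] ;; copyRight ;;
  pushAll .kindsRev [true, false, false, false] ;;
  pour .leftTmp .left ;; pour .rightTmp .right ;; .push .left true

/-- Turn the adjacency matrix into rows of kinds. -/
def matrixProg : StackProg Stack := .loop .right Option.isSome matrixRowProg

theorem runsIn_parseProg (n k : ℕ) (bits : List Bool) :
    RunsIn parseProg ({ input := encodeNat n ++ (encodeNat k ++ bits) } : Memory).get
      (3 * n + 4 * k + 9) ({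
        input := bits
        numVerts := List.replicate n true
        numSlots := List.replicate k true
        code := quad (encodeList encodeNat [k]) [] [] [] } : Memory).get := by
  let I (d r : ℕ) : Memory := {
    input := encodeNat r ++ (encodeNat k ++ bits)
    numVerts := List.replicate d true }
  let J (d r : ℕ) : Memory := {
    input := encodeNat r ++ bits
    numVerts := List.replicate n true
    numSlots := List.replicate d true
    code := quad (List.replicate d true ++ [false, false]) [] [] [] }
  have hvert (d r) : RunsIn (.pop .input ;; .push .numVerts true) (I d (r + 1)).get 2
      (I (d + 1) r).get :=
    RunsIn.congr ((runsIn_pop _ _).seq (runsIn_push _ _ _)) le_rfl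
      (by simp [I, encodeNat, List.replicate_succ])
  have hslot (d r) : RunsIn (.pop .input ;; .push .numSlots true ;; .push (.code 0) true)
      (J d (r + 1)).get 3 (J (d + 1) r).get :=
    RunsIn.congr ((runsIn_pop _ _).seq ((runsIn_push _ _ _).seq (runsIn_push _ _ _))) le_rfl
      (by simp [J, encodeNat, List.replicate_succ])
  have hverts := runsIn_loop_nat (a := .input) (c := isOne) n (fun d r => (I d r).get)
    (fun d r _ => ⟨by simp [I, encodeNat, isOne], hvert d r⟩) (by simp [I, encodeNat, isOne])
  have hslots := runsIn_loop_nat (a := .input) (c := isOne) k (fun d r => (J d r).get)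
    (fun d r _ => ⟨by simp [J, encodeNat, isOne], hslot d r⟩) (by simp [J, encodeNat, isOne])
  have hmid : RunsIn (pushAll (.code 0) [false, false])
      { I n 0 with input := encodeNat k ++ bits }.get 4 (J 0 k).get :=
    RunsIn.congr (runsIn_pushAll _ _ _) le_rfl (by simp [I, J])
  have hpop : RunsIn (.pop .input) (I n 0).get 1 { I n 0 with input := encodeNat k ++ bits }.get :=
    RunsIn.congr (runsIn_pop _ _) le_rfl (by simp [I, encodeNat])
  refine RunsIn.congr (hverts.seq (hpop.seq (hmid.seq (hslots.seq ((runsIn_pop _ _).seq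
    (runsIn_push _ _ _)))))) (by omega) ?_
  simp [J, encodeNat, encodeList, replicate_append_encodeNat]

theorem runsIn_copyBit (x : Bool) (l : List Bool) {m : Memory} (h : m.input = x :: l) :
    RunsIn copyBit m.get 7 { m with
      input := l
      kindsRev := (true :: encodeKind (bitKind x)).reverse ++ m.kindsRev }.get := by
  have hpush : RunsIn (.ite .input isOne (pushAll .kindsRev [true, false, true])
      (pushAll .kindsRev [true, false, false])) m.get 6
      { m with kindsRev := (true :: encodeKind (bitKind x)).reverse ++ m.kindsRev }.get := by
    cases x
    · exact .ite_false (by simp [h, isOne]) (RunsIn.congr (runsIn_pushAll _ _ _) le_rfl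
        (by simp [encodeKind, bitKind]))
    · exact .ite_true (by simp [h, isOne]) (RunsIn.congr (runsIn_pushAll _ _ _) le_rfl
        (by simp [encodeKind, bitKind]))
  exact RunsIn.congr (hpush.seq (runsIn_pop _ _)) le_rfl (by simp [h])

theorem runsIn_copyLeft (w rest : List Bool) {m : Memory} (hinput : m.input = w ++ rest)
    (hleft : m.left = List.replicate w.length true) (hleftTmp : m.leftTmp = []) :
    RunsIn copyLeft m.get (11 * w.length + 1) { m with
      input := rest
      left := []
      leftTmp := List.replicate w.length true
      kindsRev := (entries encodeKind (w.map bitKind)).reverse ++ m.kindsRev }.get := by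
  let I (d l : List Bool) : Memory := { m with
    input := l ++ rest
    left := List.replicate l.length true
    leftTmp := List.replicate d.length true
    kindsRev := (entries encodeKind (d.reverse.map bitKind)).reverse ++ m.kindsRev }
  have hbody (d x l) : RunsIn (moveBit .left .leftTmp ;; copyBit) (I d (x :: l)).get 10
      (I (x :: d) l).get :=
    RunsIn.congr ((Memory.runsIn_moveBit (m := I d (x :: l)) (a := .left) (b := .leftTmp)
      (by simp) (by rfl)).seq (runsIn_copyBit x (l ++ rest) (by rfl))) le_rfl
      (by simp [I, List.replicate_succ, entries_append, entries_singleton])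
  have hloop := runsIn_loop_list (a := .left) (c := Option.isSome) w (fun d l => (I d l).get)
    (fun d x l _ => ⟨by simp [I, List.replicate_succ], hbody d x l⟩) (by simp [I])
  have hstart : I [] w = m := by cases m; simp_all [I, entries]
  rw [hstart] at hloop
  exact hloop.congr (by omega) (by simp [I])

theorem runsIn_copyRight (w rest : List Bool) {m : Memory} (hinput : m.input = w ++ rest)
    (hright : m.right = List.replicate w.length true) (hrightTmp : m.rightTmp = []) :
    RunsIn copyRight m.get (11 * w.length + 1) { m with
      input := rest
      right := []
      rightTmp := List.replicate w.length true
      kindsRev := (entries encodeKind (w.map bitKind)).reverse ++ m.kindsRev }.get := by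
  let I (d l : List Bool) : Memory := { m with
    input := l ++ rest
    right := List.replicate l.length true
    rightTmp := List.replicate d.length true
    kindsRev := (entries encodeKind (d.reverse.map bitKind)).reverse ++ m.kindsRev }
  have hbody (d x l) : RunsIn (moveBit .right .rightTmp ;; copyBit) (I d (x :: l)).get 10
      (I (x :: d) l).get :=
    RunsIn.congr ((Memory.runsIn_moveBit (m := I d (x :: l)) (a := .right) (b := .rightTmp)
      (by simp) (by rfl)).seq (runsIn_copyBit x (l ++ rest) (by rfl))) le_rfl
      (by simp [I, List.replicate_succ, entries_append, entries_singleton])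
  have hloop := runsIn_loop_list (a := .right) (c := Option.isSome) w (fun d l => (I d l).get)
    (fun d x l _ => ⟨by simp [I, List.replicate_succ], hbody d x l⟩) (by simp [I])
  have hstart : I [] w = m := by cases m; simp_all [I, entries]
  rw [hstart] at hloop
  exact hloop.congr (by omega) (by simp [I])

theorem runsIn_matrixRowProg (w₁ w₂ rest : List Bool) (b : Bool) {m : Memory}
    (hinput : m.input = w₁ ++ b :: (w₂ ++ rest)) (hleft : m.left = List.replicate w₁.length true)
    (hright : m.right = List.replicate (w₂.length + 1) true) (hleftTmp : m.leftTmp = [])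
    (hrightTmp : m.rightTmp = []) :
    RunsIn matrixRowProg m.get (15 * (w₁.length + w₂.length) + 17) { m with
      input := rest
      left := List.replicate (w₁.length + 1) true
      right := List.replicate w₂.length true
      kindsRev := (encodeList encodeKind
        (((w₁ ++ b :: w₂).map bitKind).set w₁.length 0 ++ [2])).reverse ++ m.kindsRev }.get := by
  let diag : Memory := { m with
    input := w₂ ++ rest
    left := []
    leftTmp := List.replicate w₁.length true
    right := List.replicate w₂.length true
    kindsRev := (entries encodeKind (w₁.map bitKind ++ [0])).reverse ++ m.kindsRev }
  have hpop : RunsIn (.pop .right) m.get 1 { m with right := List.replicate w₂.length true }.get :=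
    RunsIn.congr (runsIn_pop _ _) le_rfl (by simp [hright])
  have hcopyLeft := runsIn_copyLeft w₁ (b :: (w₂ ++ rest))
    (m := { m with right := List.replicate w₂.length true }) hinput hleft hleftTmp
  have hpop' : RunsIn (.pop .input) { diag with
      input := b :: (w₂ ++ rest)
      kindsRev := (entries encodeKind (w₁.map bitKind)).reverse ++ m.kindsRev }.get 1 { diag with
      kindsRev := (entries encodeKind (w₁.map bitKind)).reverse ++ m.kindsRev }.get :=
    RunsIn.congr (runsIn_pop _ _) le_rfl (by simp [diag])
  have hdiag : RunsIn (pushAll .kindsRev [true, true]) { diag with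
      kindsRev := (entries encodeKind (w₁.map bitKind)).reverse ++ m.kindsRev }.get 4 diag.get :=
    RunsIn.congr (runsIn_pushAll _ _ _) le_rfl
      (by simp [diag, entries_append, entries_singleton, encodeKind])
  have hcopyRight := runsIn_copyRight w₂ rest (m := diag) rfl rfl hrightTmp
  refine RunsIn.congr (hpop.seq (hcopyLeft.seq (hpop'.seq (hdiag.seq (hcopyRight.seq
    ((runsIn_pushAll _ _ _).seq ((runsIn_pour (by simp) _).seq ((runsIn_pour (by simp) _).seq
    (runsIn_push _ _ _))))))))) ?_ ?_
  · simp only [diag, Memory.update_get, Memory.set, Memory.get, List.length_replicate,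
      List.length_cons, List.length_nil]
    omega
  · simp [diag, hleftTmp, hrightTmp, encodeList_eq_entries, entries, encodeKind,
      List.replicate_succ]

theorem runsIn_matrixProg {n : ℕ} (G : SimpleGraph (Fin n)) {m : Memory}
    (hinput : m.input = adjBits G) (hleft : m.left = []) (hright : m.right = List.replicate n true)
    (hleftTmp : m.leftTmp = []) (hrightTmp : m.rightTmp = []) (hkindsRev : m.kindsRev = []) :
    RunsIn matrixProg m.get (n * (15 * n + 18) + 1) { m with
      input := []
      left := List.replicate n true
      right := []
      kindsRev := ((rows G).flatMap (encodeList encodeKind)).reverse }.get := by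
  let I (d l : List (Fin n)) : Memory := { m with
    input := l.flatMap (adjRow G)
    left := List.replicate d.length true
    right := List.replicate l.length true
    kindsRev :=
      ((d.reverse.map fun v => List.ofFn (kind G v)).flatMap (encodeList encodeKind)).reverse }
  have hbody (d v l) (hl : d.reverse ++ v :: l = List.finRange n) :
      RunsIn matrixRowProg (I d (v :: l)).get (15 * n + 17) (I (v :: d) l).get := by
    have hlen : d.length + l.length + 1 = n := by
      simpa [Nat.add_assoc] using congrArg List.length hl
    have hv : (v : ℕ) = d.length := by
      have h : (List.finRange n)[d.length]? = some v := by rw [← hl]; simp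
      obtain ⟨_, h⟩ := List.getElem?_eq_some_iff.1 h
      simpa [Fin.ext_iff, eq_comm] using h
    obtain ⟨w₁, b, w₂, hw, hw₁, hw₂⟩ := exists_adjRow_eq_append G v
    refine (runsIn_matrixRowProg w₁ w₂ (l.flatMap (adjRow G)) b (m := I d (v :: l))
      (by simp [I, hw]) ?_ ?_ hleftTmp hrightTmp).congr (by omega) ?_
    · simp [I, hw₁, hv]
    · simp only [I, List.length_cons]
      congr 1
      omega
    · have hlw : w₂.length = l.length := by omega
      rw [← hw, hw₁, ← ofFn_kind]
      simp [I, hv, hlw, -List.ofFn_succ]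
  have hloop := runsIn_loop_list (a := .right) (c := Option.isSome) (List.finRange n)
    (fun d l => (I d l).get)
    (fun d x l hl => ⟨by simp [I, List.replicate_succ], hbody d x l hl⟩) (by simp [I])
  have hstart : I [] (List.finRange n) = m := by
    cases m
    simp_all [I, adjBits_eq_flatMap]
  rw [hstart] at hloop
  exact hloop.congr (by simp) (by simp [I, rows])

end StackProg

/-! ### Writing the output -/

theorem length_clauses (tpls : List (List Mask)) (rows : List (List (Fin 3))) :
    (clauses tpls rows).length = tpls.length * rows.length := by
  simp [clauses]

theorem encode_cnfCircuit {N : ℕ} {cls : List (List ℕ)} (h : ∀ cl ∈ cls, ∀ a ∈ cl, a < N) :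
    (cnfCircuit N cls h).encode = encodeNat N ++ (cls.flatMap encodeClause ++
      true :: ((Gate.and (List.range' N cls.length)).encode ++
        false :: encodeNat (N + cls.length))) := by
  have hor : entries Gate.encode (cls.map Gate.or) = cls.flatMap encodeClause := by
    rw [entries, List.flatMap_map]
    rfl
  simp [Circuit.encode, cnfCircuit, cnfGates, encodeList_eq_entries, entries_append,
    entries_singleton, hor]

theorem encode_reduction (χσ χρ : ℕ → Bool) (x : GraphInst) :
    (weightedCircuitSat 2 2).encode (reduction χσ χρ x) =
      encodeNat x.k ++ (encodeNat ((x.n + 1) * x.k) ++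
        ((clauses (templates χσ χρ x.k) (rows x.G)).flatMap encodeClause ++
          true :: ((Gate.and (List.range' ((x.n + 1) * x.k)
            (clauses (templates χσ χρ x.k) (rows x.G)).length)).encode ++
            false :: encodeNat ((x.n + 1) * x.k +
              (clauses (templates χσ χρ x.k) (rows x.G)).length)))) :=
  congrArg (encodeNat x.k ++ ·) (encode_cnfCircuit lt_of_mem_clauses)

namespace StackProg

/-- Write the parameter and the number of variables. -/
def headerProg : StackProg Stack :=
  emitNum .numSlots .tmp .acc ;; addNum .numSlots .tmp .numVars ;;
  .loop .numVerts Option.isSome (moveBit .numVerts .right ;; addNum .numSlots .tmp .numVars) ;;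
  emitNum .numVars .tmp .acc

/-- Write the gate that collects all clauses, and the number of the output node. -/
def footerProg : StackProg Stack :=
  pushAll .acc [true, true, false] ;;
  .loop .numClauses Option.isSome (.pop .numClauses ;; .push .acc true ;;
    emitNum .numVars .tmp .acc ;; .push .numVars true) ;;
  pushAll .acc [false, false] ;;
  emitNum .numVars .tmp .acc

/-- Put the output in its place and empty all other stacks. -/
def cleanupProg : StackProg Stack :=
  pour .acc .output ;; clear .numSlots ;; clear .left ;; clear .kindsRev ;; clear .numVars

theorem runsIn_headerProg (n k : ℕ) {m : Memory} (hverts : m.numVerts = List.replicate n true)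
    (hslots : m.numSlots = List.replicate k true) (htmp : m.tmp = []) (hvars : m.numVars = [])
    (hright : m.right = []) :
    RunsIn headerProg m.get (n * (8 * k + 6) + 8 * ((n + 1) * k) + 16 * k + 9) { m with
      numVerts := []
      right := List.replicate n true
      numVars := List.replicate ((n + 1) * k) true
      acc := (encodeNat k ++ encodeNat ((n + 1) * k)).reverse ++ m.acc }.get := by
  let I (d r : ℕ) : Memory := { m with
    numVerts := List.replicate r true
    right := List.replicate d true
    numVars := List.replicate ((d + 1) * k) true
    acc := (encodeNat k).reverse ++ m.acc }
  have hparam : RunsIn (emitNum .numSlots .tmp .acc) m.get (8 * k + 3)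
      { m with acc := (encodeNat k).reverse ++ m.acc }.get :=
    RunsIn.congr (runsIn_emitNum (by simp) (by simp) (by simp) (by exact hslots) (by exact htmp))
      le_rfl (by simp)
  have hstart : RunsIn (addNum .numSlots .tmp .numVars)
      { m with acc := (encodeNat k).reverse ++ m.acc }.get (8 * k + 2) (I 0 n).get :=
    RunsIn.congr (runsIn_addNum (by simp) (by simp) (by simp) (by exact hslots) (by exact htmp))
      le_rfl (by simp [I, hvars, ← hverts, hright])
  have hbody (d r) : RunsIn (moveBit .numVerts .right ;; addNum .numSlots .tmp .numVars)
      (I d (r + 1)).get (8 * k + 5) (I (d + 1) r).get := by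
    have hmove : RunsIn (moveBit .numVerts .right) (I d (r + 1)).get 3
        { I d r with right := List.replicate (d + 1) true }.get :=
      Memory.runsIn_moveBit (a := .numVerts) (b := .right) (by simp) (by rfl)
    refine (hmove.seq (runsIn_addNum (by simp) (by simp) (by simp) (by exact hslots)
      (by exact htmp))).congr (by omega) ?_
    have hmul : (d + 1 + 1) * k = k + (d + 1) * k := by ring
    simp [I, hmul]
  have hloop := runsIn_loop_nat (a := .numVerts) (c := Option.isSome) n (fun d r => (I d r).get)
    (fun d r _ => ⟨by simp [I, List.replicate_succ], hbody d r⟩) (by simp [I])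
  refine RunsIn.congr (hparam.seq (hstart.seq (hloop.seq (runsIn_emitNum (n := (n + 1) * k)
    (by simp) (by simp) (by simp) (by rfl) (by exact htmp))))) (by linarith) (by simp [I])

theorem runsIn_footerProg (N M : ℕ) {m : Memory} (hvars : m.numVars = List.replicate N true)
    (hclauses : m.numClauses = List.replicate M true) (htmp : m.tmp = []) :
    RunsIn footerProg m.get (M * (8 * (N + M) + 7) + 8 * (N + M) + 13) { m with
      numClauses := []
      numVars := List.replicate (N + M) true
      acc := (true :: ((Gate.and (List.range' N M)).encode ++
        false :: encodeNat (N + M))).reverse ++ m.acc }.get := by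
  let I (d r : ℕ) : Memory := { m with
    numClauses := List.replicate r true
    numVars := List.replicate (N + d) true
    acc := (entries encodeNat (List.range' N d)).reverse ++ false :: true :: true :: m.acc }
  have hstart : RunsIn (pushAll .acc [true, true, false]) m.get 5 (I 0 M).get :=
    RunsIn.congr (runsIn_pushAll _ _ _) le_rfl (by simp [I, entries, ← hvars, ← hclauses])
  have hbody (d r) (hr : d + (r + 1) = M) :
      RunsIn (.pop .numClauses ;; .push .acc true ;; emitNum .numVars .tmp .acc ;;
        .push .numVars true) (I d (r + 1)).get (8 * (N + M) + 6) (I (d + 1) r).get := by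
    have hpop : RunsIn (.pop .numClauses) (I d (r + 1)).get 1 (I d r).get :=
      RunsIn.congr (runsIn_pop _ _) le_rfl (by simp [I])
    have hpush : RunsIn (.push .acc true) (I d r).get 1
        { I d r with acc := true :: (I d r).acc }.get :=
      RunsIn.congr (runsIn_push _ _ _) le_rfl (by simp)
    refine RunsIn.congr (hpop.seq (hpush.seq ((runsIn_emitNum (n := N + d)
      (by simp) (by simp) (by simp) (by rfl) (by exact htmp)).seq (runsIn_push _ _ _))))
      (by omega) ?_
    simp [I, List.range'_1_concat, entries_append, entries_singleton, ← List.replicate_succ,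
      Nat.add_assoc]
  have hloop := runsIn_loop_nat (a := .numClauses) (c := Option.isSome) M
    (fun d r => (I d r).get) (fun d r hr => ⟨by simp [I, List.replicate_succ], hbody d r hr⟩)
    (by simp [I])
  have hsep : RunsIn (pushAll .acc [false, false]) (I M 0).get 4
      { I M 0 with acc := false :: false :: (I M 0).acc }.get :=
    RunsIn.congr (runsIn_pushAll _ _ _) le_rfl (by simp)
  refine RunsIn.congr (hstart.seq (hloop.seq (hsep.seq (runsIn_emitNum (n := N + M)
    (by simp) (by simp) (by simp) (by rfl) (by exact htmp))))) (by linarith) ?_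
  simp [I, Gate.encode, encodeList_eq_entries]

theorem runsIn_cleanupProg (m : Memory) :
    RunsIn cleanupProg m.get (12 * ∑ s, (m.get s).length + 5) { m with
      output := m.acc.reverse ++ m.output
      acc := []
      numSlots := []
      left := []
      kindsRev := []
      numVars := [] }.get := by
  have hle (s : Stack) : (m.get s).length ≤ ∑ s, (m.get s).length :=
    Finset.single_le_sum (f := fun s => (m.get s).length) (fun _ _ => Nat.zero_le _)
      (Finset.mem_univ s)
  have hacc := hle .acc
  have hslots := hle .numSlots
  have hleft := hle .left
  have hkinds := hle .kindsRev
  have hvars := hle .numVars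
  refine RunsIn.congr ((runsIn_pour (by simp) _).seq ((runsIn_clear _ _).seq
    ((runsIn_clear _ _).seq ((runsIn_clear _ _).seq (runsIn_clear _ _))))) ?_ (by simp)
  simp only [Memory.update_get, Memory.set, Memory.get] at *
  omega

/-- Read the numbers of vertices and slots, compute the templates by the program `p`, and write the
parameter and the number of variables. -/
def setupProg (p : StackProg (Fin 4)) : StackProg Stack := parseProg ;; p.map .code ;; headerProg

/-- Write the output of the reduction, given a program `p` that computes the templates. -/
def writeProg (p : StackProg (Fin 4)) : StackProg Stack :=
  setupProg p ;; matrixProg ;; clausesProg ;; footerProg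

/-- The running time of `setupProg p` for `n` vertices and `k` slots if `p` runs for `t` steps. -/
def setupTime (n k t : ℕ) : ℕ :=
  3 * n + 4 * k + 9 + (t + (n * (8 * k + 6) + 8 * ((n + 1) * k) + 16 * k + 9))

/-- The running time of `writeProg p` for `n` vertices, `k` slots and `τ` templates if `p` runs for
`t` steps. -/
def writeTime (n k τ t : ℕ) : ℕ :=
  setupTime n k t + (n * (15 * n + 18) + 1 + (τ * (templateTime k (n + 1) n + 1) + 1 +
    (τ * n * (8 * ((n + 1) * k + τ * n) + 7) + 8 * ((n + 1) * k + τ * n) + 13)))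

theorem runsIn_setupProg (n k : ℕ) (bits w : List Bool) {p : StackProg (Fin 4)} {t : ℕ}
    (hp : Runs p (quad (encodeList encodeNat [k]) [] [] []) t (quad [] w [] [])) :
    RunsIn (setupProg p) ({ input := encodeNat n ++ (encodeNat k ++ bits) } : Memory).get
      (setupTime n k t) ({
        code := quad [] w [] []
        input := bits
        numSlots := List.replicate k true
        right := List.replicate n true
        numVars := List.replicate ((n + 1) * k) true
        acc := (encodeNat k ++ encodeNat ((n + 1) * k)).reverse } : Memory).get := by
  let m (code : Fin 4 → List Bool) : Memory := {
    code
    input := bits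
    numVerts := List.replicate n true
    numSlots := List.replicate k true }
  have hcode : RunsIn (p.map Stack.code) (m (quad (encodeList encodeNat [k]) [] [] [])).get t
      (m (quad [] w [] [])).get := by
    have h := (hp.map (fun _ _ h => Stack.code.inj h) (m (quad [] [] [] [])).get).runsIn
    rwa [Memory.extend_code, Memory.extend_code] at h
  have hheader := runsIn_headerProg n k (m := m (quad [] w [] [])) rfl rfl rfl rfl rfl
  exact RunsIn.congr ((runsIn_parseProg n k bits).seq (hcode.seq hheader)) le_rfl (by simp [m])

theorem runsIn_writeProg (χσ χρ : ℕ → Bool) (x : GraphInst) {p : StackProg (Fin 4)} {t : ℕ}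
    (hp : Runs p (quad (encodeList encodeNat [x.k]) [] [] []) t
      (quad [] (templateBits χσ χρ x.k) [] [])) :
    RunsIn (writeProg p) ({ input := x.encode } : Memory).get
      (writeTime x.n x.k (templates χσ χρ x.k).length t) ({
        numSlots := List.replicate x.k true
        left := List.replicate x.n true
        kindsRev := ((rows x.G).flatMap (encodeList encodeKind)).reverse
        numVars := List.replicate ((x.n + 1) * x.k +
          (clauses (templates χσ χρ x.k) (rows x.G)).length) true
        acc := ((weightedCircuitSat 2 2).encode (reduction χσ χρ x)).reverse } : Memory).get := by
  let header := (encodeNat x.k ++ encodeNat ((x.n + 1) * x.k)).reverse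
  let cls := clauses (templates χσ χρ x.k) (rows x.G)
  let m : Memory := {
    numSlots := List.replicate x.k true
    numVars := List.replicate ((x.n + 1) * x.k) true
    acc := header }
  let m' : Memory := { m with
    left := List.replicate x.n true
    kindsRev := ((rows x.G).flatMap (encodeList encodeKind)).reverse }
  have hmatrix := runsIn_matrixProg x.G (m := { m with
    code := quad [] (templateBits χσ χρ x.k) [] []
    input := adjBits x.G
    right := List.replicate x.n true }) rfl rfl rfl rfl rfl rfl
  have hclauses := runsIn_clausesProg (templates χσ χρ x.k) (rows x.G) (k := x.k) (r := x.n + 1)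
    (m := { m' with code := quad [] (templateBits χσ χρ x.k) [] [] })
    (fun tpl h => length_of_mem_templatesOf h) (by simp [rows]) rfl rfl rfl rfl rfl rfl rfl rfl
  have hfooter := runsIn_footerProg ((x.n + 1) * x.k) cls.length (m := { m' with
    numClauses := List.replicate cls.length true
    acc := (cls.flatMap encodeClause).reverse ++ header }) rfl rfl rfl
  have hrows : (rows x.G).length = x.n := by simp [rows]
  refine RunsIn.congr ((runsIn_setupProg x.n x.k (adjBits x.G) _ hp).seq
    (hmatrix.seq (hclauses.seq hfooter))) ?_ ?_
  · rw [length_clauses, hrows, writeTime]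
  · rw [encode_reduction]
    simp only [m', m, header, cls, List.reverse_append, List.append_assoc]

theorem runsIn_reduction (χσ χρ : ℕ → Bool) (x : GraphInst) {p : StackProg (Fin 4)} {t : ℕ}
    (hp : Runs p (quad (encodeList encodeNat [x.k]) [] [] []) t
      (quad [] (templateBits χσ χρ x.k) [] [])) :
    RunsIn (writeProg p ;; cleanupProg) (Function.update (fun _ => []) .input x.encode)
      (13 * writeTime x.n x.k (templates χσ χρ x.k).length t + 12 * x.encode.length + 5)
      (Function.update (fun _ => []) .output
        ((weightedCircuitSat 2 2).encode (reduction χσ χρ x))) := by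
  have hstart : Function.update (fun _ => []) .input x.encode =
      ({ input := x.encode } : Memory).get := by
    rw [← Memory.get_default, Memory.update_get]
    rfl
  have hinput : ∑ s, (({ input := x.encode } : Memory).get s).length = x.encode.length := by
    rw [← hstart, Finset.sum_eq_single Stack.input] <;> simp +contextual
  obtain ⟨T, hT, hwrite⟩ := runsIn_writeProg χσ χρ x hp
  have hlen := hwrite.sum_length_le
  rw [hinput] at hlen
  rw [hstart, ← Memory.get_default, Memory.update_get]
  exact (hwrite.runsIn.seq (runsIn_cleanupProg _)).congr (by omega) (by simp)

end StackProg

/-! ### The running time -/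

theorem writeTime_le (n k τ t : ℕ) :
    StackProg.writeTime n k τ t ≤ 100 * ((τ + 1) ^ 2 * (k + 1) ^ 2 * (n + 1) ^ 3) + t := by
  unfold StackProg.writeTime StackProg.setupTime StackProg.templateTime StackProg.rowTime
  zify
  rw [← sub_nonneg]
  -- The difference is a polynomial with nonnegative coefficients.
  ring_nf
  positivity

/-- The factor of the bound for the running time of the reduction that depends on the parameter `k`
only, if the program for the templates runs for `t` steps and writes at most `τ` templates. -/
def paramTime (k τ t : ℕ) : ℕ := 13 * (100 * ((τ + 1) ^ 2 * (k + 1) ^ 2) + t) + 18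

theorem computable_paramTime {τ t : ℕ → ℕ} (hτ : Computable τ) (ht : Computable t) :
    Computable fun k => paramTime k (τ k) (t k) := by
  have hsq {f : ℕ × ℕ × ℕ → ℕ} (hf : Primrec f) : Primrec fun x => (f x + 1) ^ 2 := by
    simpa only [sq] using Primrec.nat_mul.comp (Primrec.succ.comp hf) (Primrec.succ.comp hf)
  have hprod : Primrec fun x : ℕ × ℕ × ℕ => (x.2.1 + 1) ^ 2 * (x.1 + 1) ^ 2 :=
    Primrec.nat_mul.comp (hsq (Primrec.fst.comp .snd)) (hsq .fst)
  have hwrite : Primrec fun x : ℕ × ℕ × ℕ => 100 * ((x.2.1 + 1) ^ 2 * (x.1 + 1) ^ 2) + x.2.2 :=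
    Primrec.nat_add.comp (Primrec.nat_mul.comp (.const 100) hprod) (Primrec.snd.comp .snd)
  have hprimrec : Primrec fun x : ℕ × ℕ × ℕ => paramTime x.1 x.2.1 x.2.2 :=
    Primrec.nat_add.comp (Primrec.nat_mul.comp (.const 13) hwrite) (.const 18)
  exact (hprimrec.to_comp.comp (Computable.id.pair (hτ.pair ht))).of_eq fun _ => rfl

theorem runningTime_lt {n l τ τ' : ℕ} (hn : n ≤ l) (hτ : τ ≤ τ') (k t : ℕ) :
    13 * StackProg.writeTime n k τ t + 12 * l + 5 < paramTime k τ' t * (l + 1) ^ 3 := by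
  have hwrite : StackProg.writeTime n k τ t ≤
      100 * ((τ' + 1) ^ 2 * (k + 1) ^ 2 * (l + 1) ^ 3) + t :=
    (writeTime_le n k τ t).trans (by gcongr)
  have hl : l + 1 ≤ (l + 1) ^ 3 := Nat.le_self_pow (by simp) _
  have ht : t ≤ t * (l + 1) ^ 3 := Nat.le_mul_of_pos_right _ (by positivity)
  unfold paramTime
  linarith

theorem length_templates_le (χσ χρ : ℕ → Bool) (k : ℕ) :
    (templates χσ χρ k).length ≤ (templateBits χσ χρ k).length := by
  have hpos (tpl : List Mask) : 1 ≤ (encodeList encodeMask tpl).length := by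
    cases tpl <;> simp [encodeList]
  rw [templateBits, List.length_flatMap]
  simpa using List.card_nsmul_le_sum ((templates χσ χρ k).map fun tpl =>
    (encodeList encodeMask tpl).length) 1 (by simpa using fun tpl _ => hpos tpl)

theorem lt_length_encode (x : GraphInst) : x.n < x.encode.length := by
  have hlen : (encodeNat x.n).length = x.n + 1 := by
    rw [← List.length_reverse, reverse_encodeNat, List.length_cons, List.length_replicate]
  rw [GraphInst.encode, List.length_append, hlen]
  omega

theorem fptReducible_weightedCircuitSat {σ ρ : Set ℕ} (hσ : ComputablePred fun n : ℕ => n ∈ σ)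
    (hρ : ComputablePred fun n : ℕ => n ∈ ρ) :
    FPTReducible (sigmaRhoDominatingSet σ ρ) (weightedCircuitSat 2 2) := by
  obtain ⟨χσ, hχσ, hσ⟩ := ComputablePred.computable_iff.1 hσ
  obtain ⟨χρ, hχρ, hρ⟩ := ComputablePred.computable_iff.1 hρ
  have hbits := computable_templateBits hχσ hχρ
  obtain ⟨p, t, ht, hp⟩ := exists_prog_computable_time hbits
  refine ⟨reduction χσ χρ, fun k => paramTime k (templateBits χσ χρ k).length (t k), id, 3,
    (StackProg.writeProg p ;; StackProg.cleanupProg).computer .input .output,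
    computable_paramTime (Computable.list_length.comp hbits) ht, Computable.id,
    yes_iff_yes_reduction (fun j => (iff_of_eq (congrFun hσ j)).symm)
      (fun j => (iff_of_eq (congrFun hρ j)).symm), fun x => le_rfl, fun x => ?_⟩
  have hrun := StackProg.runsIn_reduction χσ χρ x (hp x.k)
  have htime := runningTime_lt (lt_length_encode x).le (length_templates_le χσ χρ x.k) x.k (t x.k)
  obtain ⟨T, hT⟩ := Nat.exists_eq_add_of_lt htime
  have houtputs := (hrun.mono (Nat.le_add_right _ T)).outputsInTime
  rwa [← hT] at houtputs

end ParamComplexity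

theorem theorem2 (σ ρ : Set ℕ) (hσ : ComputablePred fun n : ℕ => n ∈ σ)
    (hρ : ComputablePred fun n : ℕ => n ∈ ρ) :
    ParamComplexity.sigmaRhoDominatingSet σ ρ ∈ ParamComplexity.W 2 :=
  ⟨2, ParamComplexity.fptReducible_weightedCircuitSat hσ hρ⟩
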